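/- Let $\kappa>0$ and let $\mathbb{H}^3_{-\kappa}$ be hyperbolic $3$-space of sectional curvature $-\kappa$, realized as the hyperboloid $-(x^0)^2+(x^1)^2+(x^2)^2+(x^3)^2=-1/\kappa$, $x^0>0$, in Minkowski space, with static coordinates $(x^1,x^2,x^3)$, $r^2=(x^1)^2+(x^2)^2+(x^3)^2$, and static potential $f=\sqrt{1+\kappa r^2}$. For all $A,B\ge 0$ there is a constant $C=C(\kappa,A,B)$ with the following property. Let $\Sigma\subset\mathbb{H}^3_{-\kappa}$ be a closed convex surface, that is, a compact connected smooth embedded surface without boundary whose second fundamental form $h_{ab}=-\langle D_{b}\,\partial_a\mathbf r,\nu\rangle$ with respect to the (outward) unit normal $\nu$ is everywhere positive semidefinite; $\Sigma$ may lie anywhere relative to the origin, in particular it may be normalized to be centered at the origin (its image in the static coordinates has center of mass $(0,0,0)$). Let $H=\sigma^{ab}h_{ab}$ be its mean curvature (the sum of the principal curvatures), and $K$ the Gauss curvature of its induced metric $\sigma$. If $$\|f\|_{C^0(\Sigma)}=\sup_\Sigma|f|\le A\quad\text{and}\quad \|K\|_{C^2(\Sigma)}=\sup_\Sigma|K|+\sup_\Sigma|\nabla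 K|_\sigma+\sup_\Sigma|\nabla^2K|_\sigma\le B,$$ then $$\max_\Sigma H\le C .$$ -/

import Mathlib

open scoped ENNReal NNReal ContDiff

noncomputable section

namespace HypSurface

/-- The ambient vector space of `ℝ^{3,1}`, with coordinates `x 0` (time), `x 1`, `x 2`, `x 3`. -/
abbrev R31 : Type := Fin 4 → ℝ

/-- The coordinate plane `ℝ²`. -/
abbrev Plane : Type := Fin 2 → ℝ

/-- The Lorentz product `-x⁰y⁰ + x¹y¹ + x²y² + x³y³`. -/
def lorentz (x y : R31) : ℝ :=
  -(x 0 * y 0) + x 1 * y 1 + x 2 * y 2 + x 3 * y 3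

/-- Hyperbolic 3-space of sectional curvature `-κ` (hyperboloid model), with the Riemannian metric
induced by the Lorentz product. -/
def hyperbolicSpace (κ : ℝ) : Set R31 :=
  {x | lorentz x x = -(1 / κ) ∧ 0 < x 0}

/-- The static potential `f = √(1 + κ r²)`; the static coordinates of `x` are `(x¹, x², x³)`, so
that `r² = (x¹)² + (x²)² + (x³)²`. -/
def staticPotential (κ : ℝ) (x : R31) : ℝ :=
  Real.sqrt (1 + κ * ((x 1) ^ 2 + (x 2) ^ 2 + (x 3) ^ 2))

/-- The partial derivative `∂F / ∂uᵃ`. -/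
def pd {V : Type*} [NormedAddCommGroup V] [NormedSpace ℝ V] (a : Fin 2) (F : Plane → V) :
    Plane → V :=
  fun u => fderiv ℝ F u (Pi.single a 1)

/-! ### Intrinsic geometry of a Riemannian metric `σ` in a coordinate domain of `ℝ²` -/

/-- Christoffel symbols `Γᶜ_{ab} = ½ σ^{cd} (∂_a σ_{bd} + ∂_b σ_{ad} - ∂_d σ_{ab})`. -/
def christoffel (σ : Plane → Matrix (Fin 2) (Fin 2) ℝ) (c a b : Fin 2) : Plane → ℝ :=
  fun u => (1 / 2) * ∑ d, (σ u)⁻¹ c d *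
    (pd a (fun v => σ v b d) u + pd b (fun v => σ v a d) u - pd d (fun v => σ v a b) u)

/-- Curvature components, `R(∂_a, ∂_b) ∂_c = Rᵈ_{cab} ∂_d`, where
`R(X, Y) = ∇_X ∇_Y - ∇_Y ∇_X - ∇_{[X, Y]}`. -/
def riemann (σ : Plane → Matrix (Fin 2) (Fin 2) ℝ) (d c a b : Fin 2) : Plane → ℝ :=
  fun u => pd a (christoffel σ d b c) u - pd b (christoffel σ d a c) u
    + ∑ e, (christoffel σ d a e u * christoffel σ e b c u
        - christoffel σ d b e u * christoffel σ e a c u)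

/-- The (intrinsic) Gauss curvature `K = ⟨R(∂₁, ∂₂) ∂₂, ∂₁⟩ / det σ` of the metric `σ`. -/
def gaussCurvature (σ : Plane → Matrix (Fin 2) (Fin 2) ℝ) : Plane → ℝ :=
  fun u => (∑ d, σ u 0 d * riemann σ d 1 0 1 u) / (σ u).det

/-- The components `φ_{;ab} = ∂_a ∂_b φ - Γᶜ_{ab} ∂_c φ` of the covariant Hessian. -/
def hessian (σ : Plane → Matrix (Fin 2) (Fin 2) ℝ) (φ : Plane → ℝ) (a b : Fin 2) : Plane → ℝ :=
  fun u => pd a (pd b φ) u - ∑ c, christoffel σ c a b u * pd c φ u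

/-- The pointwise norm `|∇φ| = (σ^{ab} φ_a φ_b)^{1/2}`. -/
def gradNorm (σ : Plane → Matrix (Fin 2) (Fin 2) ℝ) (φ : Plane → ℝ) : Plane → ℝ :=
  fun u => Real.sqrt (∑ a, ∑ b, (σ u)⁻¹ a b * pd a φ u * pd b φ u)

/-- The pointwise norm `|∇²φ| = (σ^{ac} σ^{bd} φ_{;ab} φ_{;cd})^{1/2}`. -/
def hessNorm (σ : Plane → Matrix (Fin 2) (Fin 2) ℝ) (φ : Plane → ℝ) : Plane → ℝ :=
  fun u => Real.sqrt (∑ a, ∑ b, ∑ c, ∑ d,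
    (σ u)⁻¹ a c * (σ u)⁻¹ b d * hessian σ φ a b u * hessian σ φ c d u)

/-! ### Surfaces -/

/-- A smooth regular local parametrization `r : source → S` of a piece of `S`: `r` is a smooth
immersion of an open set of the plane and a homeomorphism onto a relatively open subset of `S`. -/
structure LocalParam (S : Set R31) where
  toFun : Plane → R31
  source : Set Plane
  isOpen_source : IsOpen source
  contDiffOn : ContDiffOn ℝ ∞ toFun source
  immersion : ∀ u ∈ source, Function.Injective (fderiv ℝ toFun u)
  isEmbedding : Topology.IsEmbedding (fun u : source => toFun u)
  relOpen_image : ∃ V : Set R31, IsOpen V ∧ toFun '' source = S ∩ V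

/-- A closed surface of hyperbolic space: a compact connected smooth embedded surface without
boundary. -/
structure IsClosedSurface (κ : ℝ) (S : Set R31) : Prop where
  subset : S ⊆ hyperbolicSpace κ
  isCompact : IsCompact S
  isConnected : IsConnected S
  exists_param : ∀ p ∈ S, ∃ r : LocalParam S, p ∈ r.toFun '' r.source

namespace LocalParam

variable {S : Set R31}

/-- The induced metric (first fundamental form) `σ_{ab} = ⟨∂_a r, ∂_b r⟩`. -/
def metric (r : LocalParam S) : Plane → Matrix (Fin 2) (Fin 2) ℝ :=
  fun u => Matrix.of fun a b => lorentz (pd a r.toFun u) (pd b r.toFun u)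

/-- The second fundamental form with respect to the normal `ν`, `h_{ab} = -⟨D_b ∂_a r, ν⟩`. As the
Levi-Civita connection `D` of hyperbolic space is the tangential part of the flat derivative of
`ℝ^{3,1}` and `ν` is tangent to hyperbolic space, this is `-⟨∂_b ∂_a r, ν⟩`. With this sign,
geodesic spheres have `h > 0` for the outward normal. -/
def secondForm (r : LocalParam S) (ν : R31 → R31) : Plane → Matrix (Fin 2) (Fin 2) ℝ :=
  fun u => Matrix.of fun a b => -lorentz (pd b (pd a r.toFun) u) (ν (r.toFun u))

/-- The mean curvature `H = σ^{ab} h_{ab}`, the sum of the two principal curvatures. -/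
def meanCurvature (r : LocalParam S) (ν : R31 → R31) : Plane → ℝ :=
  fun u => ((r.metric u)⁻¹ * r.secondForm ν u).trace

/-- The Gauss curvature of the induced metric. -/
def gauss (r : LocalParam S) : Plane → ℝ := gaussCurvature r.metric

end LocalParam

/-- `ν` restricts to a smooth unit normal field of `S` in hyperbolic space: `ν` is tangent to
hyperbolic space (orthogonal to the position vector), of length one, and orthogonal to `S`. -/
structure IsUnitNormal (S : Set R31) (ν : R31 → R31) : Prop where
  tangent : ∀ p ∈ S, lorentz p (ν p) = 0
  unit : ∀ p ∈ S, lorentz (ν p) (ν p) = 1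
  normal : ∀ r : LocalParam S, ∀ u ∈ r.source, ∀ a, lorentz (pd a r.toFun u) (ν (r.toFun u)) = 0
  smooth : ∀ r : LocalParam S, ContDiffOn ℝ ∞ (fun u => ν (r.toFun u)) r.source

/-- `S` is convex with respect to the unit normal field `ν` (the outward one): the second
fundamental form is everywhere positive semidefinite. -/
def IsConvexWith (S : Set R31) (ν : R31 → R31) : Prop :=
  ∀ r : LocalParam S, ∀ u ∈ r.source, ∀ w : Plane,
    0 ≤ ∑ a, ∑ b, r.secondForm ν u a b * w a * w b

/-- The norm `‖φ‖_{C⁰(S)} = sup_S |φ|`, in `[0, ∞]`. -/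
def c0Norm (S : Set R31) (φ : R31 → ℝ) : ℝ≥0∞ := ⨆ p ∈ S, ‖φ p‖ₑ

/-- The supremum over the surface `S`, in `[0, ∞]`, of the absolute value of a quantity that is
given in local parametrizations. -/
def supNorm (S : Set R31) (Q : LocalParam S → Plane → ℝ) : ℝ≥0∞ :=
  ⨆ (r : LocalParam S), ⨆ u ∈ r.source, ‖Q r u‖ₑ

/-- The norm `‖K‖_{C²(S)} = sup |K| + sup |∇K| + sup |∇²K|` of the Gauss curvature `K` of `S`,
taken with respect to the induced metric. -/
def gaussC2Norm (S : Set R31) : ℝ≥0∞ :=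
  supNorm S (fun r => r.gauss)
    + supNorm S (fun r => gradNorm r.metric r.gauss)
    + supNorm S (fun r => hessNorm r.metric r.gauss)

end HypSurface

end

noncomputable section

namespace HypSurface

/-! ### Calculus of partial derivatives -/

section Calculus

open Filter Topology

variable {V : Type*} [NormedAddCommGroup V] [NormedSpace ℝ V] {a b : Fin 2} {u : Plane}
  {U : Set Plane}

/-! The proof is a maximum principle for `H exp (2 s x⁰)`, where `s = √κ`; on hyperbolic space `s
x⁰` is the static potential. Let λ ≥ μ ≥ 0 be the principal curvatures at a maximum point, in
coordinates that are normal and principal there (`exists_adapted`). The Gauss equation `K = λμ - κ`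
bounds λμ, so a large `H` forces λ to be large and μ to be small.

Differentiating the Gauss equation twice and commuting derivatives with the Codazzi equations gives
`simons_identity`: the operator `μ ∂₀∂₀ + λ ∂₁∂₁` applied to `H` equals `ΔK + K (λ - μ)²` plus terms
quadratic in the first derivatives of the shape operator. Convexity makes this operator degenerate
elliptic and gives `K ≥ -κ`, so the only curvature term that can hurt is at worst `-κ H²`.

The weight pays for it. The Hessian of `x⁰` is `κ x⁰ σ - ν⁰ h` (`pd_pd_pos_zero`), so the operator
applied to `x⁰` gives `κ x⁰ H - 2 λμ ν⁰`. With exponent `α = 2s` this contributes `α κ x⁰ H² ≥ 2 κ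
H²`, because `s x⁰ ≥ 1`, and a surplus `κ H²` remains. The bad gradient term `α² λ H (∂₁x⁰)²` is
absorbed by the quadratic terms of the Simons identity, since `∂₁H = -α H ∂₁x⁰` at the maximum; the
other terms grow at most linearly in `H`. Hence `H` is bounded at that point
(`le_of_maximum_conditions`), and the bound on `x⁰` carries this to the whole surface.

To run the argument on the compact set `S`, `H` must be a continuous function on `S`, independent of
parametrizations (`exists_continuousOn_meanCurvature`). -/

lemma pd_congr {F G : Plane → V} (hU : IsOpen U) (hu : u ∈ U) (h : Set.EqOn F G U) :
    pd a F u = pd a G u := by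
  have : F =ᶠ[𝓝 u] G := Filter.eventuallyEq_of_mem (hU.mem_nhds hu) h
  simp only [pd, this.fderiv_eq]

lemma diffAt_of_contDiffOn {F : Plane → V} (hU : IsOpen U) (hF : ContDiffOn ℝ ∞ F U)
    (hu : u ∈ U) : DifferentiableAt ℝ F u :=
  (hF.contDiffAt (hU.mem_nhds hu)).differentiableAt (by simp)

lemma contDiffOn_pd {F : Plane → V} (hU : IsOpen U) (hF : ContDiffOn ℝ ∞ F U) (a : Fin 2) :
    ContDiffOn ℝ ∞ (pd a F) U :=
  (hF.fderiv_of_isOpen hU (by simp)).clm_apply contDiffOn_const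

lemma pd_const (c : V) : pd a (fun _ => c) u = 0 := by simp [pd]

lemma pd_add {F G : Plane → V} (hF : DifferentiableAt ℝ F u) (hG : DifferentiableAt ℝ G u) :
    pd a (fun v => F v + G v) u = pd a F u + pd a G u := by
  simp [pd, fderiv_fun_add hF hG]

lemma pd_sub {F G : Plane → V} (hF : DifferentiableAt ℝ F u) (hG : DifferentiableAt ℝ G u) :
    pd a (fun v => F v - G v) u = pd a F u - pd a G u := by
  simp [pd, fderiv_fun_sub hF hG]

lemma pd_smul {f : Plane → ℝ} {F : Plane → V} (hf : DifferentiableAt ℝ f u)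
    (hF : DifferentiableAt ℝ F u) :
    pd a (fun v => f v • F v) u = pd a f u • F u + f u • pd a F u := by
  simp [pd, fderiv_fun_smul hf hF, add_comm]

lemma pd_mul {f g : Plane → ℝ} (hf : DifferentiableAt ℝ f u) (hg : DifferentiableAt ℝ g u) :
    pd a (fun v => f v * g v) u = pd a f u * g u + f u * pd a g u := by
  simpa using pd_smul (a := a) hf hg

lemma pd_const_mul {g : Plane → ℝ} (c : ℝ) (hg : DifferentiableAt ℝ g u) :
    pd a (fun v => c * g v) u = c * pd a g u := by
  rw [pd_mul (differentiableAt_const c) hg, pd_const, zero_mul, zero_add]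

lemma pd_apply {ι : Type*} [Fintype ι] {F : Plane → ι → ℝ} (hF : DifferentiableAt ℝ F u) (i : ι) :
    pd a (fun v => F v i) u = pd a F u i := by
  simp only [pd]
  rw [fderiv_apply hF]
  rfl

lemma pd_comm {F : Plane → V} (hU : IsOpen U) (hF : ContDiffOn ℝ ∞ F U) (hu : u ∈ U) :
    pd a (pd b F) u = pd b (pd a F) u := by
  have hF' := hF.contDiffAt (hU.mem_nhds hu)
  have hs : IsSymmSndFDerivAt ℝ F u := hF'.isSymmSndFDerivAt (by
    simpa using WithTop.coe_le_coe.2 (le_top : (2 : ℕ∞) ≤ ⊤))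
  have hd : DifferentiableAt ℝ (fderiv ℝ F) u :=
    diffAt_of_contDiffOn hU (hF.fderiv_of_isOpen hU (by simp)) hu
  have key : ∀ c d : Fin 2, pd c (pd d F) u
      = fderiv ℝ (fderiv ℝ F) u (Pi.single c 1) (Pi.single d 1) := by
    intro c d
    have : pd d F = fun v => fderiv ℝ F v (Pi.single d 1) := rfl
    rw [this]
    simp only [pd]
    rw [fderiv_clm_apply hd (differentiableAt_const _)]
    simp
  rw [key, key]
  exact hs _ _

lemma pd_exp {f : Plane → ℝ} (hf : DifferentiableAt ℝ f u) :
    pd a (fun v => Real.exp (f v)) u = Real.exp (f u) * pd a f u := by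
  simp [pd, fderiv_exp hf]

lemma fderiv_plane {F : Plane → V} (w : Plane) :
    fderiv ℝ F u w = w 0 • pd 0 F u + w 1 • pd 1 F u := by
  have : w = w 0 • (Pi.single 0 1 : Plane) + w 1 • (Pi.single 1 1 : Plane) := by
    ext i; fin_cases i <;> simp
  conv_lhs => rw [this]
  rw [map_add, map_smul, map_smul]
  rfl

lemma pd_eq_zero_of_isLocalMax {g : Plane → ℝ} (h : IsLocalMax g u) : pd a g u = 0 := by
  simp [pd, h.fderiv_eq_zero]

/-- A positive second derivative would make the point a local minimum as well, so the function would
be locally constant and its second derivative zero. -/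
lemma deriv_deriv_nonpos_of_isLocalMax {f : ℝ → ℝ} {x : ℝ} (h : IsLocalMax f x)
    (hc : ContinuousAt f x) : deriv (deriv f) x ≤ 0 := by
  by_contra! hpos
  have hmin := isLocalMin_of_deriv_deriv_pos hpos h.deriv_eq_zero hc
  have hev : f =ᶠ[𝓝 x] fun _ => f x := by
    filter_upwards [h, hmin] with y h1 h2
    exact le_antisymm h1 h2
  have h1 : deriv f =ᶠ[𝓝 x] deriv (fun _ => f x) := hev.deriv
  rw [h1.deriv_eq] at hpos
  simp at hpos

lemma pd_pd_nonpos_of_isLocalMax {g : Plane → ℝ} (hU : IsOpen U) (hg : ContDiffOn ℝ ∞ g U)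
    (hu : u ∈ U) (h : IsLocalMax g u) : pd a (pd a g) u ≤ 0 := by
  set l : ℝ → Plane := fun t => u + t • (Pi.single a 1 : Plane) with hl
  have hl0 : l 0 = u := by simp [hl]
  have hlc : Continuous l := by fun_prop
  have hld : ∀ t, HasDerivAt l (Pi.single a 1 : Plane) t := by
    intro t
    have := ((hasDerivAt_id t).smul_const (Pi.single a 1 : Plane)).const_add u
    rw [one_smul] at this
    exact this
  have hmem : ∀ᶠ t in 𝓝 (0 : ℝ), l t ∈ U :=
    hlc.continuousAt.eventually (by rw [hl0]; exact hU.mem_nhds hu)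
  have hder : ∀ {f : Plane → ℝ} {t : ℝ}, ContDiffOn ℝ ∞ f U → l t ∈ U →
      deriv (fun s => f (l s)) t = pd a f (l t) := by
    intro f t hf ht
    exact ((diffAt_of_contDiffOn hU hf ht).hasFDerivAt.comp_hasDerivAt t (hld t)).deriv
  have h1 : deriv (fun s => g (l s)) =ᶠ[𝓝 0] fun t => pd a g (l t) := by
    filter_upwards [hmem] with t ht using hder hg ht
  have hmax : IsLocalMax (fun s => g (l s)) 0 := by
    have h' : ∀ᶠ y in 𝓝 (l 0), g y ≤ g (l 0) := by rw [hl0]; exact h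
    exact hlc.continuousAt.eventually h'
  have hc : ContinuousAt (fun s => g (l s)) 0 := by
    refine ContinuousAt.comp (f := l) (g := g) ?_ hlc.continuousAt
    rw [hl0]
    exact (diffAt_of_contDiffOn hU hg hu).continuousAt
  have := deriv_deriv_nonpos_of_isLocalMax hmax hc
  rw [h1.deriv_eq, hder (contDiffOn_pd hU hg a) (by rw [hl0]; exact hu), hl0] at this
  exact this

end Calculus

/-! ### The Lorentz product -/

section Lorentz

lemma lorentz_comm (x y : R31) : lorentz x y = lorentz y x := by
  simp only [lorentz]; ring

lemma lorentz_add_left (x y z : R31) : lorentz (x + y) z = lorentz x z + lorentz y z := by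
  simp only [lorentz, Pi.add_apply]; ring

lemma lorentz_sub_left (x y z : R31) : lorentz (x - y) z = lorentz x z - lorentz y z := by
  simp only [lorentz, Pi.sub_apply]; ring

lemma lorentz_smul_left (c : ℝ) (x z : R31) : lorentz (c • x) z = c * lorentz x z := by
  simp only [lorentz, Pi.smul_apply, smul_eq_mul]; ring

lemma lorentz_zero_left (z : R31) : lorentz 0 z = 0 := by simp [lorentz]

lemma lorentz_add_right (x y z : R31) : lorentz x (y + z) = lorentz x y + lorentz x z := by
  simp only [lorentz, Pi.add_apply]; ring

lemma lorentz_sub_right (x y z : R31) : lorentz x (y - z) = lorentz x y - lorentz x z := by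
  simp only [lorentz, Pi.sub_apply]; ring

lemma lorentz_smul_right (c : ℝ) (x z : R31) : lorentz x (c • z) = c * lorentz x z := by
  simp only [lorentz, Pi.smul_apply, smul_eq_mul]; ring

lemma eq_zero_of_lorentz_eq_zero {x : R31} (h : ∀ y, lorentz x y = 0) : x = 0 := by
  ext i
  have := h (Pi.single i 1)
  fin_cases i <;> simpa [lorentz] using this

lemma pd_lorentz {a : Fin 2} {u : Plane} {F G : Plane → R31} (hF : DifferentiableAt ℝ F u)
    (hG : DifferentiableAt ℝ G u) :
    pd a (fun v => lorentz (F v) (G v)) u = lorentz (pd a F u) (G u) + lorentz (F u) (pd a G u) := by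
  have hF' := fun i => hasFDerivAt_pi'.1 hF.hasFDerivAt i
  have hG' := fun i => hasFDerivAt_pi'.1 hG.hasFDerivAt i
  have := ((((hF' 0).mul (hG' 0)).neg.add ((hF' 1).mul (hG' 1))).add
    ((hF' 2).mul (hG' 2))).add ((hF' 3).mul (hG' 3))
  have h2 : fderiv ℝ (fun v => lorentz (F v) (G v)) u = _ := this.fderiv
  simp only [pd]
  rw [h2]
  simp [lorentz]
  ring

lemma contDiffOn_lorentz {U : Set Plane} {F G : Plane → R31} (hF : ContDiffOn ℝ ∞ F U)
    (hG : ContDiffOn ℝ ∞ G U) : ContDiffOn ℝ ∞ (fun v => lorentz (F v) (G v)) U := by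
  have hF' := contDiffOn_pi.1 hF
  have hG' := contDiffOn_pi.1 hG
  exact ((((hF' 0).mul (hG' 0)).neg.add ((hF' 1).mul (hG' 1))).add
    ((hF' 2).mul (hG' 2))).add ((hF' 3).mul (hG' 3))

variable {κ : ℝ} {p X : R31}

/-- Tangency says that `p⁰X⁰` is the Euclidean product of the spatial parts, so this is
Cauchy–Schwarz. It controls the time components of unit tangent vectors and of `ν` by the static
potential. -/
lemma sq_zero_le_of_tangent (hκ : 0 < κ) (hp : p ∈ hyperbolicSpace κ) (hX : lorentz p X = 0) :
    (X 0) ^ 2 ≤ (κ * (p 0) ^ 2 - 1) * lorentz X X := by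
  obtain ⟨h1, -⟩ := hp
  simp only [lorentz] at h1 hX ⊢
  have h1' : p 1 ^ 2 + p 2 ^ 2 + p 3 ^ 2 = p 0 ^ 2 - 1 / κ := by linarith
  have hr : κ * p 0 ^ 2 - 1 = κ * (p 1 ^ 2 + p 2 ^ 2 + p 3 ^ 2) := by
    rw [h1']; field_simp
  have hX' : p 0 * X 0 = p 1 * X 1 + p 2 * X 2 + p 3 * X 3 := by linarith
  have hcs : (p 0 * X 0) ^ 2 ≤
      (p 1 ^ 2 + p 2 ^ 2 + p 3 ^ 2) * (X 1 ^ 2 + X 2 ^ 2 + X 3 ^ 2) := by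
    rw [hX']
    nlinarith [sq_nonneg (p 1 * X 2 - p 2 * X 1), sq_nonneg (p 1 * X 3 - p 3 * X 1),
      sq_nonneg (p 2 * X 3 - p 3 * X 2)]
  have hp0 : κ * p 0 ^ 2 = 1 + κ * (p 1 ^ 2 + p 2 ^ 2 + p 3 ^ 2) := by linarith
  have : κ * (p 0 * X 0) ^ 2 ≤
      κ * ((p 1 ^ 2 + p 2 ^ 2 + p 3 ^ 2) * (X 1 ^ 2 + X 2 ^ 2 + X 3 ^ 2)) :=
    mul_le_mul_of_nonneg_left hcs hκ.le
  rw [hr]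
  have e : κ * (p 0 * X 0) ^ 2 = (κ * p 0 ^ 2) * X 0 ^ 2 := by ring
  rw [e, hp0] at this
  linarith

lemma one_le_mul_sq (hκ : 0 < κ) (hp : p ∈ hyperbolicSpace κ) : 1 ≤ κ * (p 0) ^ 2 := by
  obtain ⟨h1, -⟩ := hp
  simp only [lorentz] at h1
  have h1' : p 0 ^ 2 = 1 / κ + (p 1 ^ 2 + p 2 ^ 2 + p 3 ^ 2) := by linarith
  rw [h1', mul_add, mul_one_div_cancel hκ.ne']
  have : 0 ≤ κ * (p 1 ^ 2 + p 2 ^ 2 + p 3 ^ 2) := by positivity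
  linarith

/-- Tangent vectors of the hyperboloid are spacelike; this makes the induced metric Riemannian. -/
lemma lorentz_self_pos_of_tangent (hκ : 0 < κ) (hp : p ∈ hyperbolicSpace κ)
    (hX : lorentz p X = 0) (hne : X ≠ 0) : 0 < lorentz X X := by
  have h := sq_zero_le_of_tangent hκ hp hX
  have h1 := one_le_mul_sq hκ hp
  by_contra! hle
  have h0 : X 0 ^ 2 = 0 := by nlinarith [sq_nonneg (X 0)]
  have h0' : X 0 = 0 := by simpa using h0
  simp only [lorentz, h0'] at hle
  have e1 : X 1 = 0 := by nlinarith [sq_nonneg (X 1), sq_nonneg (X 2), sq_nonneg (X 3)]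
  have e2 : X 2 = 0 := by nlinarith [sq_nonneg (X 1), sq_nonneg (X 2), sq_nonneg (X 3)]
  have e3 : X 3 = 0 := by nlinarith [sq_nonneg (X 1), sq_nonneg (X 2), sq_nonneg (X 3)]
  apply hne
  ext i
  fin_cases i <;> simp [h0', e1, e2, e3]

lemma abs_zero_le_of_unit_tangent (hκ : 0 < κ) (hp : p ∈ hyperbolicSpace κ)
    (hX : lorentz p X = 0) (h1 : lorentz X X = 1) : |X 0| ≤ Real.sqrt κ * p 0 := by
  have h := sq_zero_le_of_tangent hκ hp hX
  have h0 : 0 ≤ Real.sqrt κ * p 0 := mul_nonneg (Real.sqrt_nonneg _) hp.2.le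
  refine abs_le_of_sq_le_sq ?_ h0
  rw [mul_pow, Real.sq_sqrt hκ.le]
  rw [h1] at h
  linarith

lemma staticPotential_eq (hκ : 0 < κ) (hp : p ∈ hyperbolicSpace κ) :
    staticPotential κ p = Real.sqrt κ * p 0 := by
  have hp0 := hp.2
  have h1 := hp.1
  simp only [lorentz] at h1
  have e : 1 + κ * ((p 1) ^ 2 + (p 2) ^ 2 + (p 3) ^ 2) = κ * p 0 ^ 2 := by
    have h1' : p 1 ^ 2 + p 2 ^ 2 + p 3 ^ 2 = p 0 ^ 2 - 1 / κ := by linarith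
    rw [h1']; field_simp; ring
  rw [staticPotential, e, Real.sqrt_mul hκ.le, Real.sqrt_sq hp0.le]

/-- Two independent tangent vectors, a unit normal and the position vector form a basis. -/
lemma frame_coeff_eq_zero {e₀ e₁ n : R31} (hκ : 0 < κ) (hp : p ∈ hyperbolicSpace κ)
    (hn : lorentz n n = 1) (hpn : lorentz p n = 0) (h0p : lorentz p e₀ = 0)
    (h1p : lorentz p e₁ = 0) (h0n : lorentz e₀ n = 0) (h1n : lorentz e₁ n = 0)
    (hind : ∀ s t : ℝ, s • e₀ + t • e₁ = 0 → s = 0 ∧ t = 0) {c₀ c₁ c₂ c₃ : ℝ}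
    (h : c₀ • e₀ + c₁ • e₁ + c₂ • n + c₃ • p = 0) : c₀ = 0 ∧ c₁ = 0 ∧ c₂ = 0 ∧ c₃ = 0 := by
  have hpp : lorentz p p = -(1 / κ) := hp.1
  have e3 : c₃ = 0 := by
    have := congrArg (fun z => lorentz p z) h
    simp only [lorentz_add_right, lorentz_smul_right, lorentz_comm p 0, lorentz_zero_left,
      h0p, h1p, hpn, hpp] at this
    have hk : (1 / κ) ≠ 0 := by positivity
    have h' : c₃ * (1 / κ) = 0 := by linarith
    exact (mul_eq_zero.1 h').resolve_right hk
  have e2 : c₂ = 0 := by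
    have := congrArg (fun z => lorentz z n) h
    simp only [lorentz_add_left, lorentz_smul_left, lorentz_zero_left,
      h0n, h1n, hpn, hn] at this
    linarith
  subst e2 e3
  have := hind c₀ c₁ (by simpa using h)
  exact ⟨this.1, this.2, rfl, rfl⟩

/-- The four vectors span the whole space and the Lorentz product is nondegenerate. Vector
identities can therefore be checked by pairing with the frame. -/
lemma eq_zero_of_orthogonal_frame {e₀ e₁ n : R31} (hκ : 0 < κ) (hp : p ∈ hyperbolicSpace κ)
    (hn : lorentz n n = 1) (hpn : lorentz p n = 0) (h0p : lorentz p e₀ = 0)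
    (h1p : lorentz p e₁ = 0) (h0n : lorentz e₀ n = 0) (h1n : lorentz e₁ n = 0)
    (hind : ∀ s t : ℝ, s • e₀ + t • e₁ = 0 → s = 0 ∧ t = 0)
    (h0 : lorentz X e₀ = 0) (h1 : lorentz X e₁ = 0) (h2 : lorentz X n = 0)
    (h3 : lorentz X p = 0) : X = 0 := by
  have hli : LinearIndependent ℝ ![e₀, e₁, n, p] := by
    rw [Fintype.linearIndependent_iff]
    intro g hg
    simp only [Fin.sum_univ_four] at hg
    obtain ⟨a, b, c, d⟩ := frame_coeff_eq_zero hκ hp hn hpn h0p h1p h0n h1n hind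
      (c₀ := g 0) (c₁ := g 1) (c₂ := g 2) (c₃ := g 3) hg
    intro i
    fin_cases i <;> assumption
  have hsp := hli.span_eq_top_of_card_eq_finrank (by simp)
  apply eq_zero_of_lorentz_eq_zero
  intro y
  have hy : y ∈ Submodule.span ℝ (Set.range ![e₀, e₁, n, p]) := hsp ▸ Submodule.mem_top
  induction hy using Submodule.span_induction with
  | mem x hx =>
    obtain ⟨i, rfl⟩ := hx
    fin_cases i <;> assumption
  | zero => rw [lorentz_comm, lorentz_zero_left]
  | add x y _ _ hx hy => rw [lorentz_add_right, hx, hy, add_zero]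
  | smul c x _ hx => rw [lorentz_smul_right, hx, mul_zero]

end Lorentz

/-! ### Structure equations of a surface -/

lemma contDiffOn_matrix_inv {σ : Plane → Matrix (Fin 2) (Fin 2) ℝ} {U : Set Plane}
    (hσ : ∀ a b, ContDiffOn ℝ ∞ (fun u => σ u a b) U) (hdet : ∀ u ∈ U, (σ u).det ≠ 0)
    (a b : Fin 2) : ContDiffOn ℝ ∞ (fun u => (σ u)⁻¹ a b) U := by
  have hd : ContDiffOn ℝ ∞ (fun u => ((σ u).det)⁻¹) U := by
    refine ContDiffOn.inv ?_ hdet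
    simp only [Matrix.det_fin_two]
    exact ((hσ 0 0).mul (hσ 1 1)).sub ((hσ 0 1).mul (hσ 1 0))
  have hadj : ContDiffOn ℝ ∞ (fun u => (σ u).adjugate a b) U := by
    simp only [Matrix.adjugate_fin_two]
    fin_cases a <;> fin_cases b
    · simpa using hσ 1 1
    · simpa using (hσ 0 1).neg
    · simpa using (hσ 1 0).neg
    · simpa using hσ 0 0
  have : (fun u => (σ u)⁻¹ a b) = fun u => ((σ u).det)⁻¹ * (σ u).adjugate a b := by
    funext u
    rw [Matrix.inv_def, Ring.inverse_eq_inv']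
    rfl
  rw [this]
  exact hd.mul hadj

lemma contDiffOn_christoffel {σ : Plane → Matrix (Fin 2) (Fin 2) ℝ} {U : Set Plane}
    (hU : IsOpen U) (hσ : ∀ a b, ContDiffOn ℝ ∞ (fun u => σ u a b) U)
    (hdet : ∀ u ∈ U, (σ u).det ≠ 0) (c a b : Fin 2) :
    ContDiffOn ℝ ∞ (christoffel σ c a b) U := by
  unfold christoffel
  refine contDiffOn_const.mul (ContDiffOn.sum fun d _ => ?_)
  exact (contDiffOn_matrix_inv hσ hdet c d).mul
    (((contDiffOn_pd hU (hσ b d) a).add (contDiffOn_pd hU (hσ a d) b)).sub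
      (contDiffOn_pd hU (hσ a b) d))

namespace LocalParam

variable {S : Set R31} {κ : ℝ} {ν : R31 → R31} {u : Plane}

/-- The unit normal as a function of the parameters. -/
def normal (_r : LocalParam S) (ν : R31 → R31) : Plane → R31 := fun u => ν (_r.toFun u)

/-- The matrix `σ⁻¹ h` of the shape operator. -/
def shape (r : LocalParam S) (ν : R31 → R31) : Plane → Matrix (Fin 2) (Fin 2) ℝ :=
  fun u => (r.metric u)⁻¹ * r.secondForm ν u

variable (r : LocalParam S)

lemma mem_surface (hu : u ∈ r.source) : r.toFun u ∈ S := by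
  obtain ⟨V, -, hV⟩ := r.relOpen_image
  exact (hV ▸ Set.mem_image_of_mem _ hu : r.toFun u ∈ S ∩ V).1

lemma contDiffOn_pd (a : Fin 2) : ContDiffOn ℝ ∞ (pd a r.toFun) r.source :=
  HypSurface.contDiffOn_pd r.isOpen_source r.contDiffOn a

lemma contDiffOn_pd_pd (a b : Fin 2) : ContDiffOn ℝ ∞ (pd a (pd b r.toFun)) r.source :=
  HypSurface.contDiffOn_pd r.isOpen_source (r.contDiffOn_pd b) a

lemma contDiffOn_metric (a b : Fin 2) : ContDiffOn ℝ ∞ (fun u => r.metric u a b) r.source :=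
  contDiffOn_lorentz (r.contDiffOn_pd a) (r.contDiffOn_pd b)

lemma metric_symm (u : Plane) (a b : Fin 2) : r.metric u a b = r.metric u b a :=
  lorentz_comm _ _

lemma diffAt (hu : u ∈ r.source) : DifferentiableAt ℝ r.toFun u :=
  diffAt_of_contDiffOn r.isOpen_source r.contDiffOn hu

lemma diffAt_pd (hu : u ∈ r.source) (a : Fin 2) : DifferentiableAt ℝ (pd a r.toFun) u :=
  diffAt_of_contDiffOn r.isOpen_source (r.contDiffOn_pd a) hu

lemma linIndep_pd (hu : u ∈ r.source) (s t : ℝ)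
    (h : s • pd 0 r.toFun u + t • pd 1 r.toFun u = 0) : s = 0 ∧ t = 0 := by
  have h1 : fderiv ℝ r.toFun u ![s, t] = fderiv ℝ r.toFun u 0 := by
    rw [map_zero, fderiv_plane]
    simpa using h
  have := r.immersion u hu h1
  exact ⟨by simpa using congrFun this 0, by simpa using congrFun this 1⟩

section Hyperbolic

variable (hS : S ⊆ hyperbolicSpace κ)
include hS

lemma lorentz_pos_pd (hu : u ∈ r.source) (a : Fin 2) :
    lorentz (r.toFun u) (pd a r.toFun u) = 0 := by
  have h : Set.EqOn (fun v => lorentz (r.toFun v) (r.toFun v)) (fun _ => -(1 / κ)) r.source :=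
    fun v hv => (hS (r.mem_surface hv)).1
  have := pd_congr (a := a) r.isOpen_source hu h
  rw [pd_const, pd_lorentz (r.diffAt hu) (r.diffAt hu), lorentz_comm (pd a r.toFun u)] at this
  linarith

lemma lorentz_pos_pd_pd (hu : u ∈ r.source) (a b : Fin 2) :
    lorentz (r.toFun u) (pd a (pd b r.toFun) u) = - r.metric u a b := by
  have h : Set.EqOn (fun v => lorentz (r.toFun v) (pd b r.toFun v)) (fun _ => 0) r.source :=
    fun v hv => r.lorentz_pos_pd hS hv b
  have := pd_congr (a := a) r.isOpen_source hu h
  rw [pd_const, pd_lorentz (r.diffAt hu) (r.diffAt_pd hu b)] at this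
  have e : r.metric u a b = lorentz (pd a r.toFun u) (pd b r.toFun u) := rfl
  linarith

lemma lorentz_fderiv_pos (hκ : 0 < κ) (hu : u ∈ r.source) {w : Plane} (hw : w ≠ 0) :
    0 < lorentz (fderiv ℝ r.toFun u w) (fderiv ℝ r.toFun u w) := by
  apply lorentz_self_pos_of_tangent hκ (hS (r.mem_surface hu))
  · rw [fderiv_plane, lorentz_add_right, lorentz_smul_right, lorentz_smul_right,
      r.lorentz_pos_pd hS hu, r.lorentz_pos_pd hS hu]
    ring
  · intro h
    exact hw (r.immersion u hu (h.trans (map_zero _).symm))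

omit hS in
lemma lorentz_fderiv_fderiv (w z : Plane) :
    lorentz (fderiv ℝ r.toFun u w) (fderiv ℝ r.toFun u z) =
      ∑ a, ∑ b, r.metric u a b * w a * z b := by
  rw [fderiv_plane, fderiv_plane]
  simp only [lorentz_add_left, lorentz_add_right, lorentz_smul_left, lorentz_smul_right,
    Fin.sum_univ_two, metric, Matrix.of_apply]
  ring

lemma metric_zero_zero_pos (hκ : 0 < κ) (hu : u ∈ r.source) : 0 < r.metric u 0 0 :=
  r.lorentz_fderiv_pos hS hκ hu (w := Pi.single 0 1) (by simp)

lemma metric_det_pos (hκ : 0 < κ) (hu : u ∈ r.source) : 0 < (r.metric u).det := by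
  have h0 := r.metric_zero_zero_pos hS hκ hu
  -- On this vector the quadratic form takes the value `σ₀₀ det σ`.
  have h := r.lorentz_fderiv_pos hS hκ hu (w := ![- r.metric u 0 1, r.metric u 0 0]) (by
    intro h
    have := congrFun h 1
    simp at this
    linarith)
  rw [lorentz_fderiv_fderiv] at h
  simp only [Fin.sum_univ_two, Matrix.cons_val_zero, Matrix.cons_val_one,
    r.metric_symm u 1 0] at h
  rw [Matrix.det_fin_two, r.metric_symm u 1 0]
  have : 0 < r.metric u 0 0 *
      (r.metric u 0 0 * r.metric u 1 1 - r.metric u 0 1 * r.metric u 0 1) := by linarith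
  exact (mul_pos_iff_of_pos_left h0).1 this

lemma metric_mul_inv (hκ : 0 < κ) (hu : u ∈ r.source) : r.metric u * (r.metric u)⁻¹ = 1 :=
  Matrix.mul_nonsing_inv _ (r.metric_det_pos hS hκ hu).ne'.isUnit

lemma contDiffOn_metric_christoffel (hκ : 0 < κ) (c a b : Fin 2) :
    ContDiffOn ℝ ∞ (christoffel r.metric c a b) r.source :=
  contDiffOn_christoffel r.isOpen_source r.contDiffOn_metric
    (fun _ hu => (r.metric_det_pos hS hκ hu).ne') c a b

omit hS in
-- Expanding the derivatives of `σ` by the product rule, everything cancels in the Koszul formula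
-- except the tangential part of `∂_a ∂_b r`.
lemma christoffel_eq (hu : u ∈ r.source) (c a b : Fin 2) :
    christoffel r.metric c a b u =
      ∑ d, (r.metric u)⁻¹ c d * lorentz (pd a (pd b r.toFun) u) (pd d r.toFun u) := by
  have hm : ∀ a b c, pd c (fun v => r.metric v a b) u =
      lorentz (pd c (pd a r.toFun) u) (pd b r.toFun u)
        + lorentz (pd c (pd b r.toFun) u) (pd a r.toFun u) := by
    intro a b c
    rw [lorentz_comm (pd c (pd b r.toFun) u)]
    exact pd_lorentz (r.diffAt_pd hu a) (r.diffAt_pd hu b)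
  have hc : ∀ a b, pd a (pd b r.toFun) u = pd b (pd a r.toFun) u :=
    fun a b => pd_comm r.isOpen_source r.contDiffOn hu
  simp only [christoffel, hm]
  rw [Finset.mul_sum]
  refine Finset.sum_congr rfl fun d _ => ?_
  rw [hc b a, hc d b, hc d a]
  ring

lemma sum_metric_mul_christoffel (hκ : 0 < κ) (hu : u ∈ r.source) (c a b : Fin 2) :
    ∑ d, christoffel r.metric d a b u * r.metric u d c =
      lorentz (pd a (pd b r.toFun) u) (pd c r.toFun u) := by
  have h : r.metric u * (r.metric u)⁻¹ = 1 := r.metric_mul_inv hS hκ hu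
  have : ∀ d, christoffel r.metric d a b u =
      ((r.metric u)⁻¹.mulVec fun d => lorentz (pd a (pd b r.toFun) u) (pd d r.toFun u)) d :=
    fun d => r.christoffel_eq hu d a b
  simp only [this, r.metric_symm u _ c, mul_comm _ (r.metric u c _)]
  have e := congrFun (congrArg (fun M => Matrix.mulVec M
    fun d => lorentz (pd a (pd b r.toFun) u) (pd d r.toFun u)) h) c
  simp only [← Matrix.mulVec_mulVec, Matrix.one_mulVec] at e
  exact e

end Hyperbolic

section Normal

variable (hν : IsUnitNormal S ν)
include hν

lemma contDiffOn_normal : ContDiffOn ℝ ∞ (r.normal ν) r.source := hν.smooth r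

lemma diffAt_normal (hu : u ∈ r.source) : DifferentiableAt ℝ (r.normal ν) u :=
  diffAt_of_contDiffOn r.isOpen_source (r.contDiffOn_normal hν) hu

lemma lorentz_pd_normal (hu : u ∈ r.source) (a : Fin 2) :
    lorentz (pd a r.toFun u) (r.normal ν u) = 0 := hν.normal r u hu a

lemma lorentz_normal_pd_normal (hu : u ∈ r.source) (a : Fin 2) :
    lorentz (r.normal ν u) (pd a (r.normal ν) u) = 0 := by
  have h : Set.EqOn (fun v => lorentz (r.normal ν v) (r.normal ν v)) (fun _ => 1) r.source :=
    fun v hv => hν.unit _ (r.mem_surface hv)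
  have := pd_congr (a := a) r.isOpen_source hu h
  rw [pd_const, pd_lorentz (r.diffAt_normal hν hu) (r.diffAt_normal hν hu),
    lorentz_comm (pd a _ u)] at this
  linarith

lemma lorentz_pos_pd_normal (hu : u ∈ r.source) (a : Fin 2) :
    lorentz (r.toFun u) (pd a (r.normal ν) u) = 0 := by
  have h : Set.EqOn (fun v => lorentz (r.toFun v) (r.normal ν v)) (fun _ => 0) r.source :=
    fun v hv => hν.tangent _ (r.mem_surface hv)
  have := pd_congr (a := a) r.isOpen_source hu h
  rw [pd_const, pd_lorentz (r.diffAt hu) (r.diffAt_normal hν hu),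
    r.lorentz_pd_normal hν hu] at this
  linarith

lemma secondForm_eq (hu : u ∈ r.source) (a b : Fin 2) :
    r.secondForm ν u a b = lorentz (pd a r.toFun u) (pd b (r.normal ν) u) := by
  have h : Set.EqOn (fun v => lorentz (pd a r.toFun v) (r.normal ν v)) (fun _ => 0) r.source :=
    fun v hv => r.lorentz_pd_normal hν hv a
  have := pd_congr (a := b) r.isOpen_source hu h
  rw [pd_const, pd_lorentz (r.diffAt_pd hu a) (r.diffAt_normal hν hu)] at this
  have e : r.secondForm ν u a b = - lorentz (pd b (pd a r.toFun) u) (r.normal ν u) := rfl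
  linarith

omit hν in
lemma secondForm_symm (hu : u ∈ r.source) (a b : Fin 2) :
    r.secondForm ν u a b = r.secondForm ν u b a := by
  simp only [secondForm, Matrix.of_apply]
  rw [pd_comm r.isOpen_source r.contDiffOn hu]

lemma contDiffOn_secondForm (a b : Fin 2) :
    ContDiffOn ℝ ∞ (fun u => r.secondForm ν u a b) r.source :=
  (contDiffOn_lorentz (r.contDiffOn_pd_pd b a) (r.contDiffOn_normal hν)).neg

variable (hκ : 0 < κ) (hS : S ⊆ hyperbolicSpace κ)
include hκ hS

lemma eq_zero_of_orthogonal (hu : u ∈ r.source) {X : R31}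
    (h0 : lorentz X (pd 0 r.toFun u) = 0) (h1 : lorentz X (pd 1 r.toFun u) = 0)
    (h2 : lorentz X (r.normal ν u) = 0) (h3 : lorentz X (r.toFun u) = 0) : X = 0 :=
  eq_zero_of_orthogonal_frame hκ (hS (r.mem_surface hu)) (hν.unit _ (r.mem_surface hu))
    (hν.tangent _ (r.mem_surface hu)) (r.lorentz_pos_pd hS hu 0) (r.lorentz_pos_pd hS hu 1)
    (hν.normal r u hu 0) (hν.normal r u hu 1) (r.linIndep_pd hu) h0 h1 h2 h3

lemma coeff_eq_zero (hu : u ∈ r.source) {c₀ c₁ c₂ c₃ : ℝ}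
    (h : c₀ • pd 0 r.toFun u + c₁ • pd 1 r.toFun u + c₂ • r.normal ν u + c₃ • r.toFun u = 0) :
    c₀ = 0 ∧ c₁ = 0 ∧ c₂ = 0 ∧ c₃ = 0 :=
  frame_coeff_eq_zero hκ (hS (r.mem_surface hu)) (hν.unit _ (r.mem_surface hu))
    (hν.tangent _ (r.mem_surface hu)) (r.lorentz_pos_pd hS hu 0) (r.lorentz_pos_pd hS hu 1)
    (hν.normal r u hu 0) (hν.normal r u hu 1) (r.linIndep_pd hu) h

lemma contDiffOn_shape (a b : Fin 2) : ContDiffOn ℝ ∞ (fun u => r.shape ν u a b) r.source := by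
  simp only [shape, Matrix.mul_apply]
  refine ContDiffOn.sum fun c _ => ?_
  exact (contDiffOn_matrix_inv r.contDiffOn_metric
    (fun u hu => (r.metric_det_pos hS hκ hu).ne') a c).mul (r.contDiffOn_secondForm hν c b)

omit hν in
lemma metric_mul_shape (hu : u ∈ r.source) : r.metric u * r.shape ν u = r.secondForm ν u := by
  rw [shape, ← Matrix.mul_assoc, r.metric_mul_inv hS hκ hu, Matrix.one_mul]

omit hν in
lemma sum_metric_mul_shape (hu : u ∈ r.source) (a b : Fin 2) :
    r.metric u a 0 * r.shape ν u 0 b + r.metric u a 1 * r.shape ν u 1 b =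
      r.secondForm ν u a b := by
  rw [← r.metric_mul_shape hκ hS hu, Matrix.mul_apply, Fin.sum_univ_two]

/-- The Gauss formula `∂_a ∂_b r = Γᶜ_{ab} ∂_c r - h_{ab} ν + κ σ_{ab} r`. -/
lemma gauss_formula (hu : u ∈ r.source) (a b : Fin 2) :
    pd a (pd b r.toFun) u =
      christoffel r.metric 0 a b u • pd 0 r.toFun u + christoffel r.metric 1 a b u • pd 1 r.toFun u
        - r.secondForm ν u a b • r.normal ν u + (κ * r.metric u a b) • r.toFun u := by
  have hΓ := fun c => r.sum_metric_mul_christoffel hS hκ hu c a b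
  simp only [Fin.sum_univ_two] at hΓ
  have hp := hS (r.mem_surface hu)
  have hpp : lorentz (r.toFun u) (r.toFun u) = -(1 / κ) := hp.1
  have hm : ∀ a b, lorentz (pd a r.toFun u) (pd b r.toFun u) = r.metric u a b := fun _ _ => rfl
  have hnn : lorentz (r.normal ν u) (r.normal ν u) = 1 := hν.unit _ (r.mem_surface hu)
  have hpn : lorentz (r.toFun u) (r.normal ν u) = 0 := hν.tangent _ (r.mem_surface hu)
  have h0 := r.lorentz_pos_pd hS hu
  have h1 := r.lorentz_pd_normal hν hu
  have hh : lorentz (pd a (pd b r.toFun) u) (r.normal ν u) = - r.secondForm ν u a b := by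
    rw [r.secondForm_symm hu]; simp [secondForm, normal]
  have hr := r.lorentz_pos_pd_pd hS hu a b
  rw [← sub_eq_zero]
  refine r.eq_zero_of_orthogonal hν hκ hS hu ?_ ?_ ?_ ?_
  · simp only [lorentz_sub_left, lorentz_add_left, lorentz_smul_left, ← hΓ, hm, h0,
      lorentz_comm (r.normal ν u), h1]
    ring
  · simp only [lorentz_sub_left, lorentz_add_left, lorentz_smul_left, ← hΓ, hm, h0,
      lorentz_comm (r.normal ν u), h1]
    ring
  · simp only [lorentz_sub_left, lorentz_add_left, lorentz_smul_left, hh, hnn, hpn, h1]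
    ring
  · rw [lorentz_comm]
    simp only [lorentz_sub_right, lorentz_add_right, lorentz_smul_right, hr, hpp, h0, hpn]
    field_simp
    ring

/-- The Weingarten formula `∂_a ν = Aᶜ_a ∂_c r`. -/
lemma weingarten (hu : u ∈ r.source) (a : Fin 2) :
    pd a (r.normal ν) u =
      r.shape ν u 0 a • pd 0 r.toFun u + r.shape ν u 1 a • pd 1 r.toFun u := by
  have hA := fun c => r.sum_metric_mul_shape (ν := ν) hκ hS hu c a
  have hm : ∀ a b, lorentz (pd a r.toFun u) (pd b r.toFun u) = r.metric u a b := fun _ _ => rfl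
  have h0 := r.lorentz_pos_pd hS hu
  have h1 := r.lorentz_pd_normal hν hu
  have h2 := r.lorentz_normal_pd_normal hν hu a
  have h3 := r.lorentz_pos_pd_normal hν hu a
  have h4 := fun c => r.secondForm_eq hν hu c a
  rw [← sub_eq_zero]
  refine r.eq_zero_of_orthogonal hν hκ hS hu ?_ ?_ ?_ ?_
  · simp only [lorentz_sub_left, lorentz_add_left, lorentz_smul_left, hm,
      lorentz_comm (pd a (r.normal ν) u), ← h4, ← hA, r.metric_symm u 1 0]
    ring
  · simp only [lorentz_sub_left, lorentz_add_left, lorentz_smul_left, hm,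
      lorentz_comm (pd a (r.normal ν) u), ← h4, ← hA, r.metric_symm u 1 0]
    ring
  · simp only [lorentz_sub_left, lorentz_add_left, lorentz_smul_left, h1,
      lorentz_comm (pd a (r.normal ν) u), h2]
    ring
  · rw [lorentz_comm]
    simp only [lorentz_sub_right, lorentz_add_right, lorentz_smul_right, h0, h3]
    ring

end Normal

end LocalParam

/-! ### The Codazzi and Gauss equations -/

namespace LocalParam

variable {S : Set R31} {κ : ℝ} {ν : R31 → R31} {u : Plane} (r : LocalParam S)
  (hν : IsUnitNormal S ν) (hκ : 0 < κ) (hS : S ⊆ hyperbolicSpace κ)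

include hκ hS

lemma diffAt_christoffel (hu : u ∈ r.source) (c a b : Fin 2) :
    DifferentiableAt ℝ (christoffel r.metric c a b) u :=
  diffAt_of_contDiffOn r.isOpen_source (r.contDiffOn_metric_christoffel hS hκ c a b) hu

include hν

lemma diffAt_shape (hu : u ∈ r.source) (a b : Fin 2) :
    DifferentiableAt ℝ (fun v => r.shape ν v a b) u :=
  diffAt_of_contDiffOn r.isOpen_source (r.contDiffOn_shape hν hκ hS a b) hu

/-- Differentiate the Gauss formula and substitute the Gauss and Weingarten formulas again. Only the
tangential coefficients are recorded, because they alone enter the Gauss equation when third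
derivatives are commuted. -/
lemma exists_pd_pd_pd_eq (hu : u ∈ r.source) (a b c : Fin 2) :
    ∃ X Y : ℝ, pd a (pd b (pd c r.toFun)) u =
      (pd a (christoffel r.metric 0 b c) u
        + christoffel r.metric 0 b c u * christoffel r.metric 0 a 0 u
        + christoffel r.metric 1 b c u * christoffel r.metric 0 a 1 u
        - r.secondForm ν u b c * r.shape ν u 0 a) • pd 0 r.toFun u
      + (pd a (christoffel r.metric 1 b c) u
        + christoffel r.metric 0 b c u * christoffel r.metric 1 a 0 u
        + christoffel r.metric 1 b c u * christoffel r.metric 1 a 1 u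
        - r.secondForm ν u b c * r.shape ν u 1 a) • pd 1 r.toFun u
      + (κ * r.metric u b c) • pd a r.toFun u + X • r.normal ν u + Y • r.toFun u := by
  have hd := r.diffAt_pd hu
  have hΓ := fun d => r.diffAt_christoffel hκ hS hu d b c
  have hn := r.diffAt_normal hν hu
  have hh := diffAt_of_contDiffOn r.isOpen_source (r.contDiffOn_secondForm hν b c) hu
  have hσ : DifferentiableAt ℝ (fun v => κ * r.metric v b c) u :=
    (diffAt_of_contDiffOn r.isOpen_source (r.contDiffOn_metric b c) hu).const_mul κ
  rw [pd_congr r.isOpen_source hu fun v hv => r.gauss_formula hν hκ hS hv b c,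
    pd_add ((((hΓ 0).fun_smul (hd 0)).fun_add ((hΓ 1).fun_smul (hd 1))).fun_sub (hh.fun_smul hn))
      (hσ.fun_smul (r.diffAt hu)),
    pd_sub (((hΓ 0).fun_smul (hd 0)).fun_add ((hΓ 1).fun_smul (hd 1))) (hh.fun_smul hn),
    pd_add ((hΓ 0).fun_smul (hd 0)) ((hΓ 1).fun_smul (hd 1)), pd_smul (hΓ 0) (hd 0),
    pd_smul (hΓ 1) (hd 1), pd_smul hh hn, pd_smul hσ (r.diffAt hu),
    r.gauss_formula hν hκ hS hu a 0, r.gauss_formula hν hκ hS hu a 1,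
    r.weingarten hν hκ hS hu a]
  refine ⟨- christoffel r.metric 0 b c u * r.secondForm ν u a 0
    - christoffel r.metric 1 b c u * r.secondForm ν u a 1
    - pd a (fun v => r.secondForm ν v b c) u,
    christoffel r.metric 0 b c u * (κ * r.metric u a 0)
    + christoffel r.metric 1 b c u * (κ * r.metric u a 1)
    + pd a (fun v => κ * r.metric v b c) u, ?_⟩
  module

/-- The analogue for the normal, from the Weingarten formula: commuting the two derivatives and
comparing tangential coefficients gives Codazzi. -/
lemma exists_pd_pd_normal_eq (hu : u ∈ r.source) (a b : Fin 2) :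
    ∃ X Y : ℝ, pd b (pd a (r.normal ν)) u =
      (pd b (fun v => r.shape ν v 0 a) u
        + r.shape ν u 0 a * christoffel r.metric 0 b 0 u
        + r.shape ν u 1 a * christoffel r.metric 0 b 1 u) • pd 0 r.toFun u
      + (pd b (fun v => r.shape ν v 1 a) u
        + r.shape ν u 0 a * christoffel r.metric 1 b 0 u
        + r.shape ν u 1 a * christoffel r.metric 1 b 1 u) • pd 1 r.toFun u
      + X • r.normal ν u + Y • r.toFun u := by
  have hd := r.diffAt_pd hu
  have hA := fun d => r.diffAt_shape hν hκ hS hu d a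
  rw [pd_congr r.isOpen_source hu fun v hv => r.weingarten hν hκ hS hv a,
    pd_add ((hA 0).fun_smul (hd 0)) ((hA 1).fun_smul (hd 1)), pd_smul (hA 0) (hd 0),
    pd_smul (hA 1) (hd 1),
    r.gauss_formula hν hκ hS hu b 0, r.gauss_formula hν hκ hS hu b 1]
  refine ⟨- r.shape ν u 0 a * r.secondForm ν u b 0 - r.shape ν u 1 a * r.secondForm ν u b 1,
    r.shape ν u 0 a * (κ * r.metric u b 0) + r.shape ν u 1 a * (κ * r.metric u b 1), ?_⟩
  module

/-- The Codazzi equations `A^c_{0;1} = A^c_{1;0}`. -/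
lemma codazzi (hu : u ∈ r.source) (c : Fin 2) :
    pd 1 (fun v => r.shape ν v c 0) u
        + r.shape ν u 0 0 * christoffel r.metric c 1 0 u
        + r.shape ν u 1 0 * christoffel r.metric c 1 1 u =
      pd 0 (fun v => r.shape ν v c 1) u
        + r.shape ν u 0 1 * christoffel r.metric c 0 0 u
        + r.shape ν u 1 1 * christoffel r.metric c 0 1 u := by
  obtain ⟨X, Y, h⟩ := r.exists_pd_pd_normal_eq hν hκ hS hu 0 1
  obtain ⟨X', Y', h'⟩ := r.exists_pd_pd_normal_eq hν hκ hS hu 1 0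
  have e := pd_comm (a := 1) (b := 0) r.isOpen_source (r.contDiffOn_normal hν) hu
  rw [h, h', ← sub_eq_zero] at e
  have := r.coeff_eq_zero hν hκ hS hu (Eq.trans (by module) e)
    (c₀ := (pd 1 (fun v => r.shape ν v 0 0) u
        + r.shape ν u 0 0 * christoffel r.metric 0 1 0 u
        + r.shape ν u 1 0 * christoffel r.metric 0 1 1 u)
      - (pd 0 (fun v => r.shape ν v 0 1) u
        + r.shape ν u 0 1 * christoffel r.metric 0 0 0 u
        + r.shape ν u 1 1 * christoffel r.metric 0 0 1 u))
    (c₁ := (pd 1 (fun v => r.shape ν v 1 0) u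
        + r.shape ν u 0 0 * christoffel r.metric 1 1 0 u
        + r.shape ν u 1 0 * christoffel r.metric 1 1 1 u)
      - (pd 0 (fun v => r.shape ν v 1 1) u
        + r.shape ν u 0 1 * christoffel r.metric 1 0 0 u
        + r.shape ν u 1 1 * christoffel r.metric 1 0 1 u))
    (c₂ := X - X') (c₃ := Y - Y')
  fin_cases c
  · exact sub_eq_zero.1 this.1
  · exact sub_eq_zero.1 this.2.1

/-- The Gauss equation `K = det A - κ`. -/
lemma gauss_equation (hu : u ∈ r.source) :
    r.gauss u = r.shape ν u 0 0 * r.shape ν u 1 1 - r.shape ν u 0 1 * r.shape ν u 1 0 - κ := by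
  obtain ⟨X, Y, h⟩ := r.exists_pd_pd_pd_eq hν hκ hS hu 0 1 1
  obtain ⟨X', Y', h'⟩ := r.exists_pd_pd_pd_eq hν hκ hS hu 1 0 1
  have e := pd_comm (a := 0) (b := 1) r.isOpen_source (r.contDiffOn_pd 1) hu
  rw [h, h', ← sub_eq_zero] at e
  have := r.coeff_eq_zero hν hκ hS hu (Eq.trans (by module) e)
    (c₀ := (pd 0 (christoffel r.metric 0 1 1) u
        + christoffel r.metric 0 1 1 u * christoffel r.metric 0 0 0 u
        + christoffel r.metric 1 1 1 u * christoffel r.metric 0 0 1 u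
        - r.secondForm ν u 1 1 * r.shape ν u 0 0)
        - (pd 1 (christoffel r.metric 0 0 1) u
        + christoffel r.metric 0 0 1 u * christoffel r.metric 0 1 0 u
        + christoffel r.metric 1 0 1 u * christoffel r.metric 0 1 1 u
        - r.secondForm ν u 0 1 * r.shape ν u 0 1) + κ * r.metric u 1 1)
    (c₁ := (pd 0 (christoffel r.metric 1 1 1) u
        + christoffel r.metric 0 1 1 u * christoffel r.metric 1 0 0 u
        + christoffel r.metric 1 1 1 u * christoffel r.metric 1 0 1 u
        - r.secondForm ν u 1 1 * r.shape ν u 1 0)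
        - (pd 1 (christoffel r.metric 1 0 1) u
        + christoffel r.metric 0 0 1 u * christoffel r.metric 1 1 0 u
        + christoffel r.metric 1 0 1 u * christoffel r.metric 1 1 1 u
        - r.secondForm ν u 0 1 * r.shape ν u 1 1) - κ * r.metric u 0 1)
    (c₂ := X - X') (c₃ := Y - Y')
  obtain ⟨h0, h1, -, -⟩ := this
  have hA := fun a b => r.sum_metric_mul_shape (ν := ν) hκ hS hu a b
  have hdet := r.metric_det_pos hS hκ hu
  have hs := r.metric_symm u 1 0
  rw [gauss, gaussCurvature, div_eq_iff hdet.ne']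
  rw [Matrix.det_fin_two] at hdet ⊢
  simp only [Fin.sum_univ_two, riemann]
  rw [← hA, ← hA] at h0 h1
  have hsy := r.secondForm_symm (ν := ν) hu 0 1
  rw [← hA, ← hA] at hsy
  -- Pairing with the row `σ₀_d` lowers the index and produces the numerator of the Gauss curvature;
  -- the last two terms use the symmetry of `σ` and of `h`.
  linear_combination r.metric u 0 0 * h0 + r.metric u 0 1 * h1 -
    (κ * r.metric u 0 1) * hs -
    (r.metric u 0 0 * r.shape ν u 0 1 + r.metric u 0 1 * r.shape ν u 1 1) * hsy

omit hν in
/-- Compatibility of the Levi-Civita connection with the metric. -/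
lemma pd_metric (hu : u ∈ r.source) (c a b : Fin 2) :
    pd c (fun v => r.metric v a b) u =
      christoffel r.metric 0 c a u * r.metric u 0 b + christoffel r.metric 1 c a u * r.metric u 1 b
      + (christoffel r.metric 0 c b u * r.metric u 0 a
        + christoffel r.metric 1 c b u * r.metric u 1 a) := by
  have h1 := r.sum_metric_mul_christoffel hS hκ hu b c a
  have h2 := r.sum_metric_mul_christoffel hS hκ hu a c b
  rw [Fin.sum_univ_two] at h1 h2
  rw [h1, h2, lorentz_comm (pd c (pd b r.toFun) u)]
  exact pd_lorentz (r.diffAt_pd hu a) (r.diffAt_pd hu b)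

end LocalParam

/-! ### Change of parametrization -/

namespace LocalParam

open Filter Topology

variable {S : Set R31} {κ : ℝ} {ν : R31 → R31} {u : Plane}

/-- Parametrizations are open maps into `S`: the embedding property handles neighbourhoods inside
the image, and the image is itself relatively open. -/
lemma image_mem_nhdsWithin (r : LocalParam S) (hu : u ∈ r.source) {W : Set Plane}
    (hW : W ∈ 𝓝 u) : r.toFun '' (r.source ∩ W) ∈ 𝓝[S] (r.toFun u) := by
  obtain ⟨V, hVo, hV⟩ := r.relOpen_image
  have huV : r.toFun u ∈ V := (hV ▸ Set.mem_image_of_mem _ hu : r.toFun u ∈ S ∩ V).2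
  have hW' : (fun x : r.source => (x : Plane)) ⁻¹' W ∈ 𝓝 (⟨u, hu⟩ : r.source) :=
    continuous_subtype_val.continuousAt.preimage_mem_nhds hW
  rw [r.isEmbedding.nhds_eq_comap, mem_comap] at hW'
  obtain ⟨O, hO, hOW⟩ := hW'
  rw [mem_nhdsWithin_iff_exists_mem_nhds_inter]
  refine ⟨V ∩ O, inter_mem (hVo.mem_nhds huV) hO, ?_⟩
  rintro p ⟨⟨hpV, hpO⟩, hpS⟩
  obtain ⟨x, hx, rfl⟩ : p ∈ r.toFun '' r.source := hV ▸ ⟨hpS, hpV⟩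
  exact ⟨x, ⟨hx, hOW (show (⟨x, hx⟩ : r.source) ∈ _ from hpO)⟩, rfl⟩

/-- The differentials of two parametrizations, and of the normal in them, are related by the
differential of the transition map. -/
lemma exists_transition (hν : IsUnitNormal S ν) (r₁ r₂ : LocalParam S) {u₁ u₂ : Plane}
    (hu₁ : u₁ ∈ r₁.source) (hu₂ : u₂ ∈ r₂.source) (h : r₁.toFun u₁ = r₂.toFun u₂) :
    ∃ J : Plane →L[ℝ] Plane, Function.Injective J ∧
      (∀ w, fderiv ℝ r₁.toFun u₁ w = fderiv ℝ r₂.toFun u₂ (J w)) ∧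
      (∀ w, fderiv ℝ (r₁.normal ν) u₁ w = fderiv ℝ (r₂.normal ν) u₂ (J w)) := by
  -- A linear left inverse `L` of the differential turns `r₂` into a local diffeomorphism `L ∘ r₂`
  -- of the plane. With `g` its local inverse, the transition map is `g ∘ L ∘ r₁`.
  obtain ⟨L₀, hL₀⟩ := LinearMap.exists_leftInverse_of_injective
    (fderiv ℝ r₂.toFun u₂ : Plane →ₗ[ℝ] R31) (LinearMap.ker_eq_bot.2 (r₂.immersion u₂ hu₂))
  set L : R31 →L[ℝ] Plane := LinearMap.toContinuousLinearMap L₀ with hL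
  have hLr : L.comp (fderiv ℝ r₂.toFun u₂) =
      ((ContinuousLinearEquiv.refl ℝ Plane : Plane ≃L[ℝ] Plane) : Plane →L[ℝ] Plane) := by
    ext1 w
    exact LinearMap.congr_fun hL₀ w
  have hs : HasStrictFDerivAt r₂.toFun (fderiv ℝ r₂.toFun u₂) u₂ :=
    (r₂.contDiffOn.contDiffAt (r₂.isOpen_source.mem_nhds hu₂)).hasStrictFDerivAt (by simp)
  have hq : HasStrictFDerivAt (fun x => L (r₂.toFun x))
      ((ContinuousLinearEquiv.refl ℝ Plane : Plane ≃L[ℝ] Plane) : Plane →L[ℝ] Plane) u₂ := by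
    rw [← hLr]
    exact L.hasStrictFDerivAt.comp u₂ hs
  set g := hq.localInverse _ _ _ with hg
  have hgd : DifferentiableAt ℝ g (L (r₁.toFun u₁)) := by
    rw [h]
    exact hq.to_localInverse.hasFDerivAt.differentiableAt
  have hg0 : g (L (r₁.toFun u₁)) = u₂ := by
    rw [h]
    exact hq.localInverse_apply_image
  have hginv : ∀ᶠ x in 𝓝 u₂, g (L (r₂.toFun x)) = x := hq.eventually_left_inverse
  set ψ : Plane → Plane := fun u => g (L (r₁.toFun u)) with hψ
  have hr₁ := r₁.diffAt hu₁
  have hψd : DifferentiableAt ℝ ψ u₁ :=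
    hgd.comp u₁ (L.differentiableAt.comp u₁ hr₁)
  have hev : ∀ᶠ u in 𝓝 u₁, r₁.toFun u = r₂.toFun (ψ u) := by
    have him := r₂.image_mem_nhdsWithin hu₂ hginv
    rw [← h] at him
    have ht : Tendsto r₁.toFun (𝓝 u₁) (𝓝[S] (r₁.toFun u₁)) :=
      tendsto_nhdsWithin_iff.2 ⟨hr₁.continuousAt, by
        filter_upwards [r₁.isOpen_source.mem_nhds hu₁] with x hx using r₁.mem_surface hx⟩
    filter_upwards [ht him] with u hu
    obtain ⟨x, ⟨-, hx⟩, hxu⟩ := hu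
    have hx' : g (L (r₂.toFun x)) = x := hx
    simp only [hψ, ← hxu, hx']
  have e₁ : r₁.toFun =ᶠ[𝓝 u₁] r₂.toFun ∘ ψ := hev
  have e₂ : r₁.normal ν =ᶠ[𝓝 u₁] r₂.normal ν ∘ ψ := by
    filter_upwards [hev] with u hu
    simp only [normal, Function.comp, hu]
  have hψ0 : ψ u₁ = u₂ := hg0
  have d₁ : fderiv ℝ r₁.toFun u₁ = (fderiv ℝ r₂.toFun u₂).comp (fderiv ℝ ψ u₁) := by
    rw [e₁.fderiv_eq, fderiv_comp _ (by rw [hψ0]; exact r₂.diffAt hu₂) hψd, hψ0]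
  have d₂ : fderiv ℝ (r₁.normal ν) u₁ = (fderiv ℝ (r₂.normal ν) u₂).comp (fderiv ℝ ψ u₁) := by
    rw [e₂.fderiv_eq, fderiv_comp _ (by rw [hψ0]; exact r₂.diffAt_normal hν hu₂) hψd, hψ0]
  refine ⟨fderiv ℝ ψ u₁, ?_, fun w => by rw [d₁]; rfl, fun w => by rw [d₂]; rfl⟩
  have hinj := r₁.immersion u₁ hu₁
  rw [d₁] at hinj
  exact Function.Injective.of_comp hinj

lemma fderiv_normal (r : LocalParam S) (hν : IsUnitNormal S ν) (hκ : 0 < κ)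
    (hS : S ⊆ hyperbolicSpace κ) (hu : u ∈ r.source) (w : Plane) :
    fderiv ℝ (r.normal ν) u w = fderiv ℝ r.toFun u ((r.shape ν u).mulVec w) := by
  rw [fderiv_plane, fderiv_plane, r.weingarten hν hκ hS hu, r.weingarten hν hκ hS hu]
  simp only [Matrix.mulVec, dotProduct, Fin.sum_univ_two]
  module

/-- The differential of the transition map conjugates the two shape operators, since both satisfy
`dν = dr ∘ A`; conjugate matrices have equal trace. -/
lemma meanCurvature_eq_of_eq (hν : IsUnitNormal S ν) (hκ : 0 < κ) (hS : S ⊆ hyperbolicSpace κ)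
    (r₁ r₂ : LocalParam S) {u₁ u₂ : Plane}
    (hu₁ : u₁ ∈ r₁.source) (hu₂ : u₂ ∈ r₂.source) (h : r₁.toFun u₁ = r₂.toFun u₂) :
    r₁.meanCurvature ν u₁ = r₂.meanCurvature ν u₂ := by
  obtain ⟨J, hJ, hr, hn⟩ := exists_transition hν r₁ r₂ hu₁ hu₂ h
  set M := LinearMap.toMatrix' (J : Plane →ₗ[ℝ] Plane) with hM
  have hMv : ∀ w, M.mulVec w = J w := fun w => LinearMap.toMatrix'_mulVec _ w
  have hcomm : M * r₁.shape ν u₁ = r₂.shape ν u₂ * M := by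
    apply Matrix.ext_of_mulVec_single
    intro i
    rw [← Matrix.mulVec_mulVec, ← Matrix.mulVec_mulVec, hMv, hMv]
    apply r₂.immersion u₂ hu₂
    rw [← hr, ← r₁.fderiv_normal hν hκ hS hu₁, hn, r₂.fderiv_normal hν hκ hS hu₂]
  have hMu : IsUnit M := by
    rw [← Matrix.mulVec_injective_iff_isUnit]
    intro x y hxy
    exact hJ (by simpa [hMv] using hxy)
  have hdet : IsUnit M.det := (Matrix.isUnit_iff_isUnit_det M).1 hMu
  change (r₁.shape ν u₁).trace = (r₂.shape ν u₂).trace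
  calc (r₁.shape ν u₁).trace = (M⁻¹ * (M * r₁.shape ν u₁)).trace := by
        rw [Matrix.nonsing_inv_mul_cancel_left _ _ hdet]
    _ = (M * M⁻¹ * r₂.shape ν u₂).trace := by
        rw [hcomm, ← Matrix.mul_assoc, Matrix.trace_mul_comm, Matrix.mul_assoc]
    _ = _ := by rw [Matrix.mul_nonsing_inv _ hdet, Matrix.one_mul]

end LocalParam

open LocalParam Filter Topology in
/-- The mean curvature is a continuous function on the surface. -/
lemma exists_continuousOn_meanCurvature {S : Set R31} {κ : ℝ} {ν : R31 → R31} (hκ : 0 < κ)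
    (hS : IsClosedSurface κ S) (hν : IsUnitNormal S ν) :
    ∃ H : R31 → ℝ, ContinuousOn H S ∧
      ∀ r : LocalParam S, ∀ u ∈ r.source, H (r.toFun u) = r.meanCurvature ν u := by
  classical
  obtain ⟨p₀, hp₀⟩ := hS.isConnected.nonempty
  have : Nonempty (LocalParam S) := ⟨(hS.exists_param p₀ hp₀).choose⟩
  choose! R hR using hS.exists_param
  choose! x hx using hR
  have key : ∀ r : LocalParam S, ∀ u ∈ r.source,
      (R (r.toFun u)).meanCurvature ν (x (r.toFun u)) = r.meanCurvature ν u := by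
    intro r u hu
    have := hx _ (r.mem_surface hu)
    exact meanCurvature_eq_of_eq hν hκ hS.subset _ _ this.1 hu this.2
  refine ⟨fun p => (R p).meanCurvature ν (x p), ?_, key⟩
  intro p hp
  obtain ⟨r, u, hu, rfl⟩ := hS.exists_param p hp
  intro N hN
  replace hN : N ∈ 𝓝 (r.meanCurvature ν u) := by rw [← key r u hu]; exact hN
  have hc : ContinuousAt (r.meanCurvature ν) u := by
    have : r.meanCurvature ν = fun v => r.shape ν v 0 0 + r.shape ν v 1 1 := by
      funext v
      exact Matrix.trace_fin_two _
    rw [this]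
    exact (r.diffAt_shape hν hκ hS.subset hu 0 0).continuousAt.add
      (r.diffAt_shape hν hκ hS.subset hu 1 1).continuousAt
  refine mem_map.2 <| mem_of_superset (r.image_mem_nhdsWithin hu (hc hN)) ?_
  rintro _ ⟨y, ⟨hy, hyN⟩, rfl⟩
  change (R (r.toFun y)).meanCurvature ν (x (r.toFun y)) ∈ N
  rw [key r y hy]
  exact hyN

/-! ### Parametrizations adapted to a point -/

open Matrix in
/-- Simultaneous diagonalization of a positive definite and a symmetric form in dimension two. -/
lemma exists_diagonalization {σ h : Matrix (Fin 2) (Fin 2) ℝ} (hσ : σ 1 0 = σ 0 1)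
    (hpos : 0 < σ 0 0) (hdet : 0 < σ.det) (hh : h 1 0 = h 0 1) :
    ∃ P : Matrix (Fin 2) (Fin 2) ℝ, Pᵀ * σ * P = 1 ∧ (Pᵀ * h * P) 0 1 = 0 ∧
      (Pᵀ * h * P) 1 0 = 0 ∧ (Pᵀ * h * P) 1 1 ≤ (Pᵀ * h * P) 0 0 := by
  have entry : ∀ M P : Matrix (Fin 2) (Fin 2) ℝ, ∀ a b, (Pᵀ * M * P) a b =
      M 0 0 * P 0 a * P 0 b + M 0 1 * P 0 a * P 1 b + M 1 0 * P 1 a * P 0 b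
        + M 1 1 * P 1 a * P 1 b := by
    intro M P a b
    simp only [Matrix.mul_apply, Matrix.transpose_apply, Fin.sum_univ_two]
    ring
  rw [Matrix.det_fin_two, hσ] at hdet
  obtain ⟨Q, hQ⟩ : ∃ Q : Matrix (Fin 2) (Fin 2) ℝ, Qᵀ * σ * Q = 1 := by
    set s := Real.sqrt (σ 0 0)
    set d := Real.sqrt (σ 0 0 * σ 1 1 - σ 0 1 * σ 0 1)
    have hs : 0 < s := Real.sqrt_pos.2 hpos
    have hd : 0 < d := Real.sqrt_pos.2 hdet
    have hs2 : s ^ 2 = σ 0 0 := Real.sq_sqrt hpos.le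
    have hd2 : d ^ 2 = σ 0 0 * σ 1 1 - σ 0 1 * σ 0 1 := Real.sq_sqrt hdet.le
    -- Gram–Schmidt applied to the coordinate basis.
    refine ⟨!![1 / s, -σ 0 1 / (s * d); 0, s / d], ?_⟩
    ext a b
    rw [entry]
    fin_cases a <;> fin_cases b
    · simp [← hs2]
      field_simp
    · simp [← hs2]
      field_simp
      ring
    · simp [← hs2, hσ]
      field_simp
      ring
    · have h11 : σ 1 1 = (d ^ 2 + σ 0 1 * σ 0 1) / s ^ 2 := by
        rw [hd2, hs2]; field_simp; ring
      simp [← hs2, hσ, h11]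
      field_simp
      ring
  set k := Qᵀ * h * Q with hk
  have hk10 : k 1 0 = k 0 1 := by
    rw [hk, entry, entry, hh]; ring
  -- Rotation by `t` turns the trace-free part of `k`, seen as a complex number, by the angle `-2t`.
  -- Half the argument of `z` therefore makes it real and nonnegative, which diagonalizes `k` and
  -- puts the larger eigenvalue first.
  set z : ℂ := ⟨(k 0 0 - k 1 1) / 2, k 0 1⟩ with hz
  have hc2 : ‖z‖ * Real.cos z.arg = (k 0 0 - k 1 1) / 2 := Complex.norm_mul_cos_arg z
  have hs2 : ‖z‖ * Real.sin z.arg = k 0 1 := Complex.norm_mul_sin_arg z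
  set t := z.arg / 2 with ht
  have harg : z.arg = 2 * t := by rw [ht]; ring
  rw [harg] at hc2 hs2
  rw [Real.cos_two_mul] at hc2
  rw [Real.sin_two_mul] at hs2
  have hsc := Real.sin_sq_add_cos_sq t
  have hn : 0 ≤ ‖z‖ := norm_nonneg z
  generalize ‖z‖ = R at hc2 hs2 hn
  generalize Real.cos t = c at hc2 hs2 hsc
  generalize Real.sin t = s at hc2 hs2 hsc
  set T : Matrix (Fin 2) (Fin 2) ℝ := !![c, -s; s, c] with hT
  have hmul : ∀ M : Matrix (Fin 2) (Fin 2) ℝ, (Q * T)ᵀ * M * (Q * T) = Tᵀ * (Qᵀ * M * Q) * T := by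
    intro M
    simp only [Matrix.transpose_mul, Matrix.mul_assoc]
  have hk00 : k 0 0 = k 1 1 + 2 * (R * (2 * c ^ 2 - 1)) := by linarith
  have hk01 : k 0 1 = R * (2 * s * c) := hs2.symm
  have hs' : s ^ 2 = 1 - c ^ 2 := by linarith
  refine ⟨Q * T, ?_, ?_, ?_, ?_⟩
  · rw [hmul, hQ]
    ext a b
    rw [entry]
    fin_cases a <;> fin_cases b <;> simp [hT] <;> nlinarith
  · rw [hmul, ← hk, entry, hk10, hk01, hk00]
    simp [hT]
    linear_combination (-2 * R * c * s) * hs'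
  · rw [hmul, ← hk, entry, hk10, hk01, hk00]
    simp [hT]
    linear_combination (-2 * R * c * s) * hs'
  · rw [hmul, ← hk, entry, entry, hk10, hk01, hk00]
    simp [hT]
    have : 0 ≤ 2 * R := by linarith
    have e : R * (2 * c ^ 2 - 1) * (c ^ 2 - s ^ 2) + R * (2 * s * c) * (2 * s * c) = R := by
      rw [show R * (2 * c ^ 2 - 1) * (c ^ 2 - s ^ 2) + R * (2 * s * c) * (2 * s * c) =
        R * (2 * c ^ 2 - 1) * (c ^ 2 - s ^ 2) + R * 4 * s ^ 2 * c ^ 2 by ring, hs']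
      ring
    nlinarith

/-! ### Coordinates that are normal and principal at a point -/

namespace LocalParam

open Filter Topology

variable {S : Set R31} {κ : ℝ} {ν : R31 → R31} {u : Plane}

/-- A parametrization in terms of the values of a map `q` that is a local diffeomorphism. -/
lemma exists_reparam (r : LocalParam S) (hu : u ∈ r.source) {q : Plane → Plane}
    (hq : ContDiffOn ℝ ∞ q r.source) (hinj : Function.Injective (fderiv ℝ q u)) :
    ∃ r' : LocalParam S, q u ∈ r'.source ∧ r'.toFun (q u) = r.toFun u ∧
      ∀ v ∈ r'.source, ∃ x ∈ r.source, r'.toFun v = r.toFun x ∧ q x = v := by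
  have hqa : ∀ x ∈ r.source, ContDiffAt ℝ ∞ q x := fun x hx =>
    hq.contDiffAt (r.isOpen_source.mem_nhds hx)
  have hequiv : ∃ E : Plane ≃L[ℝ] Plane, (E : Plane →L[ℝ] Plane) = fderiv ℝ q u := by
    refine ⟨(LinearEquiv.ofInjectiveEndo (fderiv ℝ q u : Plane →ₗ[ℝ] Plane)
      hinj).toContinuousLinearEquiv, ?_⟩
    ext1 w
    rfl
  obtain ⟨E, hE⟩ := hequiv
  have hEd : HasFDerivAt q (E : Plane →L[ℝ] Plane) u := by
    rw [hE]
    exact ((hqa u hu).differentiableAt (by simp)).hasFDerivAt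
  set e₀ := (hqa u hu).toOpenPartialHomeomorph q hEd (by simp) with he₀
  -- Restricting to points with invertible differential makes the inverse smooth on its whole
  -- domain, not only at `q u`.
  set O : Set Plane := r.source ∩ fderiv ℝ q ⁻¹' Set.range
    ((↑) : (Plane ≃L[ℝ] Plane) → Plane →L[ℝ] Plane) with hO
  have hOo : IsOpen O :=
    (hq.fderiv_of_isOpen r.isOpen_source (m := ∞) (by simp)).continuousOn.isOpen_inter_preimage
      r.isOpen_source ContinuousLinearEquiv.isOpen
  set e := e₀.restrOpen O hOo with he
  have heq : ∀ x, e x = q x := fun x => rfl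
  have hes : e.source = e₀.source ∩ O := rfl
  have hesub : ∀ v ∈ e.target, e.symm v ∈ r.source := fun v hv => by
    have := e.map_target hv
    rw [hes] at this
    exact this.2.1
  have hqe : ∀ v ∈ e.target, q (e.symm v) = v := fun v hv => e.right_inv hv
  have hsmooth : ∀ v ∈ e.target, ContDiffAt ℝ ∞ e.symm v := by
    intro v hv
    have hm := e.map_target hv
    rw [hes] at hm
    obtain ⟨F, hF⟩ := hm.2.2
    refine e.contDiffAt_symm (f₀' := F) hv ?_ (hqa _ (hesub v hv))
    rw [hF]
    exact ((hqa _ (hesub v hv)).differentiableAt (by simp)).hasFDerivAt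
  have hue : u ∈ e.source := by
    rw [hes]
    exact ⟨(hqa u hu).mem_toOpenPartialHomeomorph_source hEd (by simp), hu, E, hE⟩
  let r' : LocalParam S :=
    { toFun := fun v => r.toFun (e.symm v)
      source := e.target
      isOpen_source := e.open_target
      contDiffOn := r.contDiffOn.comp (fun v hv => (hsmooth v hv).contDiffWithinAt) hesub
      immersion := by
        intro v hv
        have hd : DifferentiableAt ℝ e.symm v := (hsmooth v hv).differentiableAt (by simp)
        have h1 : fderiv ℝ (fun v => r.toFun (e.symm v)) v =
            (fderiv ℝ r.toFun (e.symm v)).comp (fderiv ℝ e.symm v) :=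
          fderiv_comp v (r.diffAt (hesub v hv)) hd
        rw [h1]
        refine (r.immersion _ (hesub v hv)).comp ?_
        have h2 : (fun v => q (e.symm v)) =ᶠ[𝓝 v] id :=
          eventually_of_mem (e.open_target.mem_nhds hv) hqe
        have h3 : (fderiv ℝ q (e.symm v)).comp (fderiv ℝ e.symm v) =
            ContinuousLinearMap.id ℝ Plane := by
          rw [← fderiv_id (x := v), ← h2.fderiv_eq]
          exact (fderiv_comp v ((hqa _ (hesub v hv)).differentiableAt (by simp)) hd).symm
        exact Function.LeftInverse.injective (g := fderiv ℝ q (e.symm v))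
          fun w => DFunLike.congr_fun h3 w
      isEmbedding := by
        have hsub : e.source ⊆ r.source := fun x hx => hx.2.1
        exact (r.isEmbedding.comp (Topology.IsEmbedding.inclusion hsub)).comp
          e.toHomeomorphSourceTarget.symm.isEmbedding
      relOpen_image := by
        obtain ⟨V, hVo, hV⟩ := r.relOpen_image
        obtain ⟨N, hNo, hN⟩ := r.isEmbedding.isInducing.isOpen_iff.1
          (e.open_source.preimage (continuous_subtype_val : Continuous ((↑) : r.source → Plane)))
        refine ⟨V ∩ N, hVo.inter hNo, ?_⟩
        ext p
        constructor
        · rintro ⟨v, hv, rfl⟩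
          have h1 : r.toFun (e.symm v) ∈ S ∩ V := hV ▸ Set.mem_image_of_mem _ (hesub v hv)
          refine ⟨h1.1, h1.2, ?_⟩
          have h2 : (⟨e.symm v, hesub v hv⟩ : r.source) ∈
              ((↑) : r.source → Plane) ⁻¹' e.source := e.map_target hv
          rw [← hN] at h2
          exact h2
        · rintro ⟨hpS, hpV, hpN⟩
          obtain ⟨x, hx, rfl⟩ : p ∈ r.toFun '' r.source := hV ▸ ⟨hpS, hpV⟩
          have h2 : (⟨x, hx⟩ : r.source) ∈ ((↑) : r.source → Plane) ⁻¹' e.source := by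
            rw [← hN]; exact hpN
          have h3 : x ∈ e.source := h2
          exact ⟨e x, e.map_source h3, by simp only [e.left_inv h3]⟩ }
  refine ⟨r', e.map_source hue, ?_, fun v hv => ⟨e.symm v, hesub v hv, rfl, hqe v hv⟩⟩
  change r.toFun (e.symm (e u)) = r.toFun u
  rw [e.left_inv hue]

lemma lorentz_fderiv_fderiv_normal (r : LocalParam S) (hν : IsUnitNormal S ν) (hu : u ∈ r.source)
    (w z : Plane) : lorentz (fderiv ℝ r.toFun u w) (fderiv ℝ (r.normal ν) u z) =
      ∑ a, ∑ b, r.secondForm ν u a b * w a * z b := by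
  rw [fderiv_plane, fderiv_plane]
  simp only [lorentz_add_left, lorentz_add_right, lorentz_smul_left, lorentz_smul_right,
    Fin.sum_univ_two, r.secondForm_eq hν hu]
  ring

open Matrix in
/-- Every point has a parametrization that is normal and principal at this point. -/
lemma exists_adapted (r : LocalParam S) (hν : IsUnitNormal S ν) (hκ : 0 < κ)
    (hS : S ⊆ hyperbolicSpace κ) (hu : u ∈ r.source) :
    ∃ r' : LocalParam S, ∃ v ∈ r'.source, r'.toFun v = r.toFun u ∧ r'.metric v = 1 ∧
      (∀ c a b, christoffel r'.metric c a b v = 0) ∧ r'.shape ν v 0 1 = 0 ∧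
      r'.shape ν v 1 0 = 0 ∧ r'.shape ν v 1 1 ≤ r'.shape ν v 0 0 := by
  obtain ⟨P, hP, h01, h10, hle⟩ := exists_diagonalization (r.metric_symm u 1 0)
    (r.metric_zero_zero_pos hS hκ hu) (r.metric_det_pos hS hκ hu)
    (r.secondForm_symm (ν := ν) hu 1 0)
  have entry : ∀ M : Matrix (Fin 2) (Fin 2) ℝ, ∀ a b, (Pᵀ * M * P) a b =
      ∑ i, ∑ j, M i j * P i a * P j b := by
    intro M a b
    simp only [Matrix.mul_apply, Matrix.transpose_apply, Fin.sum_univ_two]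
    ring
  -- `Pᵀ a` is the `a`-th column of `P`, so `E` is an orthonormal principal frame of the tangent
  -- plane.
  set E : Fin 2 → R31 := fun a => fderiv ℝ r.toFun u (Pᵀ a) with hE
  have hEw : ∀ w a, lorentz (fderiv ℝ r.toFun u w) (E a) = ((Pᵀ * r.metric u) *ᵥ w) a := by
    intro w a
    rw [hE, lorentz_fderiv_fderiv]
    simp only [Matrix.mulVec, dotProduct, Matrix.mul_apply, Matrix.transpose_apply,
      Fin.sum_univ_two, r.metric_symm u 1 0]
    ring
  have hinv : P * (Pᵀ * r.metric u) = 1 := mul_eq_one_comm.1 hP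
  have hzero : ∀ w : Plane, (∀ a, lorentz (fderiv ℝ r.toFun u w) (E a) = 0) → w = 0 := by
    intro w hw
    have h1 : (Pᵀ * r.metric u) *ᵥ w = 0 := by
      ext a
      rw [← hEw, hw]; rfl
    rw [← Matrix.one_mulVec w, ← hinv, ← Matrix.mulVec_mulVec, h1, Matrix.mulVec_zero]
  have hEE : ∀ a b, lorentz (E a) (E b) = (1 : Matrix (Fin 2) (Fin 2) ℝ) a b := by
    intro a b
    rw [← hP, entry]
    exact r.lorentz_fderiv_fderiv _ _
  -- The new coordinates are the products with the fixed vectors `E a`. They are linear functions of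
  -- the position, so second derivatives of the new parametrization are orthogonal to the tangent
  -- plane at the point, and the Christoffel symbols vanish there.
  set q : Plane → Plane := fun x a => lorentz (r.toFun x) (E a) with hq
  have hqs : ContDiffOn ℝ ∞ q r.source :=
    contDiffOn_pi.2 fun a => contDiffOn_lorentz r.contDiffOn contDiffOn_const
  have hqd : ∀ a b, pd b q u a = lorentz (pd b r.toFun u) (E a) := by
    intro a b
    rw [← pd_apply (diffAt_of_contDiffOn r.isOpen_source hqs hu) a]
    change pd b (fun x => lorentz (r.toFun x) (E a)) u = _
    rw [pd_lorentz (r.diffAt hu) (differentiableAt_const _), pd_const, lorentz_comm _ 0,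
      lorentz_zero_left, add_zero]
  have hqinj : Function.Injective (fderiv ℝ q u) := by
    rw [injective_iff_map_eq_zero]
    intro w hw
    apply hzero
    intro a
    have := congrFun hw a
    rw [fderiv_plane] at this ⊢
    rw [lorentz_add_left, lorentz_smul_left, lorentz_smul_left, ← hqd, ← hqd]
    exact this
  obtain ⟨r', hv, hru, hr'⟩ := r.exists_reparam hu hqs hqinj
  set v := q u with hvdef
  have hlin : ∀ x ∈ r'.source, ∀ a, lorentz (r'.toFun x) (E a) = x a := by
    intro x hx a
    obtain ⟨y, -, hy, hxy⟩ := hr' x hx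
    rw [hy, ← hxy]
  have hpdlin : ∀ x ∈ r'.source, ∀ a b, lorentz (pd b r'.toFun x) (E a) =
      (1 : Matrix (Fin 2) (Fin 2) ℝ) a b := by
    intro x hx a b
    have h1 := pd_congr (a := b) r'.isOpen_source hx fun y hy => hlin y hy a
    rw [pd_lorentz (r'.diffAt hx) (differentiableAt_const _), pd_const, lorentz_comm _ 0,
      lorentz_zero_left, add_zero] at h1
    rw [h1, pd_apply (F := fun y => y) differentiableAt_id a]
    simp [pd, Matrix.one_apply, Pi.single_apply]
  have hpdpd : ∀ a b c, lorentz (pd c (pd b r'.toFun) v) (E a) = 0 := by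
    intro a b c
    have h1 := pd_congr (a := c) r'.isOpen_source hv fun y hy => hpdlin y hy a b
    rwa [pd_lorentz (r'.diffAt_pd hv b) (differentiableAt_const _), pd_const, lorentz_comm _ 0,
      lorentz_zero_left, add_zero, pd_const] at h1
  obtain ⟨J, -, hJr, hJn⟩ := exists_transition hν r' r hv hu hru
  have hJ : ∀ b, J (Pi.single b 1) = Pᵀ b := by
    intro b
    rw [← sub_eq_zero]
    apply hzero
    intro a
    rw [map_sub, lorentz_sub_left, ← hJr]
    change lorentz (pd b r'.toFun v) (E a) - lorentz (E b) (E a) = 0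
    rw [hpdlin v hv, lorentz_comm, hEE, sub_self]
  have hpr : ∀ b, pd b r'.toFun v = E b := fun b => by
    rw [hE, pd, hJr, hJ]
  have hpn : ∀ b, pd b (r'.normal ν) v = fderiv ℝ (r.normal ν) u (Pᵀ b) := fun b => by
    rw [pd, hJn, hJ]
  have hm : r'.metric v = 1 := by
    ext a b
    change lorentz (pd a r'.toFun v) (pd b r'.toFun v) = _
    rw [hpr, hpr, hEE]
  have hsh : ∀ a b, r'.shape ν v a b = (Pᵀ * r.secondForm ν u * P) a b := by
    intro a b
    rw [shape, hm, inv_one, Matrix.one_mul, r'.secondForm_eq hν hv, hpr, hpn, hE,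
      r.lorentz_fderiv_fderiv_normal hν hu, entry]
    rfl
  refine ⟨r', v, hv, hru, hm, ?_, ?_, ?_, ?_⟩
  · intro c a b
    rw [r'.christoffel_eq hv]
    refine Finset.sum_eq_zero fun d _ => ?_
    rw [hpr, hpdpd, mul_zero]
  · rw [hsh, h01]
  · rw [hsh, h10]
  · rw [hsh, hsh]; exact hle

end LocalParam

/-! ### The second derivatives of the mean curvature at a point -/

section SecondDerivatives

variable {U : Set Plane} {u : Plane} {f g : Plane → ℝ}

lemma pd_pd_mul (hU : IsOpen U) (hf : ContDiffOn ℝ ∞ f U) (hg : ContDiffOn ℝ ∞ g U) (hu : u ∈ U)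
    (a b : Fin 2) :
    pd a (pd b fun v => f v * g v) u = pd a (pd b f) u * g u + pd b f u * pd a g u
      + (pd a f u * pd b g u + f u * pd a (pd b g) u) := by
  have hd : ∀ {φ : Plane → ℝ}, ContDiffOn ℝ ∞ φ U → ∀ v ∈ U, DifferentiableAt ℝ φ v :=
    fun hφ v hv => diffAt_of_contDiffOn hU hφ hv
  have hf' := hd (contDiffOn_pd hU hf b) u hu
  have hg' := hd (contDiffOn_pd hU hg b) u hu
  have h := pd_congr (a := a) hU hu
    (fun v hv => pd_mul (a := b) (hd hf v hv) (hd hg v hv) :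
      Set.EqOn (pd b fun v => f v * g v) (fun v => pd b f v * g v + f v * pd b g v) U)
  rw [h, pd_add (hf'.fun_mul (hd hg u hu)) ((hd hf u hu).fun_mul hg'), pd_mul hf' (hd hg u hu),
    pd_mul (hd hf u hu) hg']

lemma pd_pd_add (hU : IsOpen U) (hf : ContDiffOn ℝ ∞ f U) (hg : ContDiffOn ℝ ∞ g U) (hu : u ∈ U)
    (a b : Fin 2) :
    pd a (pd b fun v => f v + g v) u = pd a (pd b f) u + pd a (pd b g) u := by
  have hd : ∀ {φ : Plane → ℝ}, ContDiffOn ℝ ∞ φ U → ∀ v ∈ U, DifferentiableAt ℝ φ v :=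
    fun hφ v hv => diffAt_of_contDiffOn hU hφ hv
  have h := pd_congr (a := a) hU hu
    (fun v hv => pd_add (a := b) (hd hf v hv) (hd hg v hv) :
      Set.EqOn (pd b fun v => f v + g v) (fun v => pd b f v + pd b g v) U)
  rw [h, pd_add (hd (contDiffOn_pd hU hf b) u hu) (hd (contDiffOn_pd hU hg b) u hu)]

lemma pd_pd_sub (hU : IsOpen U) (hf : ContDiffOn ℝ ∞ f U) (hg : ContDiffOn ℝ ∞ g U) (hu : u ∈ U)
    (a b : Fin 2) :
    pd a (pd b fun v => f v - g v) u = pd a (pd b f) u - pd a (pd b g) u := by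
  have hd : ∀ {φ : Plane → ℝ}, ContDiffOn ℝ ∞ φ U → ∀ v ∈ U, DifferentiableAt ℝ φ v :=
    fun hφ v hv => diffAt_of_contDiffOn hU hφ hv
  have h := pd_congr (a := a) hU hu
    (fun v hv => pd_sub (a := b) (hd hf v hv) (hd hg v hv) :
      Set.EqOn (pd b fun v => f v - g v) (fun v => pd b f v - pd b g v) U)
  rw [h, pd_sub (hd (contDiffOn_pd hU hf b) u hu) (hd (contDiffOn_pd hU hg b) u hu)]

lemma pd_add_mul_add_mul {f g₁ h₁ g₂ h₂ : Plane → ℝ} (a : Fin 2) (hf : DifferentiableAt ℝ f u)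
    (hg₁ : DifferentiableAt ℝ g₁ u) (hh₁ : DifferentiableAt ℝ h₁ u)
    (hg₂ : DifferentiableAt ℝ g₂ u) (hh₂ : DifferentiableAt ℝ h₂ u) :
    pd a (fun v => f v + g₁ v * h₁ v + g₂ v * h₂ v) u =
      pd a f u + (pd a g₁ u * h₁ u + g₁ u * pd a h₁ u)
        + (pd a g₂ u * h₂ u + g₂ u * pd a h₂ u) := by
  rw [pd_add (hf.fun_add (hg₁.fun_mul hh₁)) (hg₂.fun_mul hh₂), pd_add hf (hg₁.fun_mul hh₁),
    pd_mul hg₁ hh₁, pd_mul hg₂ hh₂]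

/-- The first and second order conditions at a maximum of `H exp (α φ)`. -/
lemma conditions_of_isLocalMax_mul_exp {H φ : Plane → ℝ} (hU : IsOpen U)
    (hH : ContDiffOn ℝ ∞ H U) (hφ : ContDiffOn ℝ ∞ φ U) (hu : u ∈ U) (α : ℝ)
    (hmax : IsLocalMax (fun v => H v * Real.exp (α * φ v)) u) (c : Fin 2) :
    pd c H u = -(α * H u * pd c φ u) ∧
      pd c (pd c H) u + α * (H u * pd c (pd c φ) u) - α ^ 2 * H u * pd c φ u ^ 2 ≤ 0 := by
  have hαφ : ContDiffOn ℝ ∞ (fun v => α * φ v) U := contDiffOn_const.mul hφ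
  have he : ContDiffOn ℝ ∞ (fun v => Real.exp (α * φ v)) U := hαφ.exp
  have hd : ∀ {φ : Plane → ℝ}, ContDiffOn ℝ ∞ φ U → ∀ v ∈ U, DifferentiableAt ℝ φ v :=
    fun hφ v hv => diffAt_of_contDiffOn hU hφ hv
  have hpe : ∀ v ∈ U, pd c (fun v => Real.exp (α * φ v)) v
      = α * (Real.exp (α * φ v) * pd c φ v) := by
    intro v hv
    rw [pd_exp (hd hαφ v hv), pd_const_mul α (hd hφ v hv)]
    ring
  have hppe : pd c (pd c (fun v => Real.exp (α * φ v))) u =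
      α * (α * (Real.exp (α * φ u) * pd c φ u) * pd c φ u
        + Real.exp (α * φ u) * pd c (pd c φ) u) := by
    have hφc := hd (contDiffOn_pd hU hφ c) u hu
    rw [pd_congr hU hu hpe, pd_const_mul α ((hd he u hu).fun_mul hφc), pd_mul (hd he u hu) hφc,
      hpe u hu]
  have h1 := pd_eq_zero_of_isLocalMax (a := c) hmax
  have h2 := pd_pd_nonpos_of_isLocalMax (a := c) hU (hH.mul he) hu hmax
  rw [pd_mul (hd hH u hu) (hd he u hu), hpe u hu] at h1
  rw [pd_pd_mul hU hH he hu, hppe, hpe u hu] at h2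
  have hpos := Real.exp_pos (α * φ u)
  have h1' : pd c H u + α * H u * pd c φ u = 0 := by
    have : Real.exp (α * φ u) * (pd c H u + α * H u * pd c φ u) = 0 := by linarith
    exact (mul_eq_zero.1 this).resolve_left hpos.ne'
  refine ⟨by linarith, ?_⟩
  refine nonpos_of_mul_nonpos_right (a := Real.exp (α * φ u)) ?_ hpos
  have e : pd c H u = -(α * H u * pd c φ u) := by linarith
  rw [e] at h2
  linarith

end SecondDerivatives

/-! ### The Simons identity and the Hessian of `x⁰` -/

namespace LocalParam

variable {S : Set R31} {κ : ℝ} {ν : R31 → R31} {u : Plane} (r : LocalParam S)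

lemma christoffel_symm (c a b : Fin 2) : christoffel r.metric c a b = christoffel r.metric c b a := by
  funext v
  have : (fun v => r.metric v a b) = fun v => r.metric v b a :=
    funext fun v => r.metric_symm v a b
  simp only [christoffel, this]
  congr 1
  refine Finset.sum_congr rfl fun d _ => ?_
  ring

variable (hν : IsUnitNormal S ν) (hκ : 0 < κ) (hS : S ⊆ hyperbolicSpace κ)
include hν hκ hS

/-- The Simons type identity for the mean curvature, at a point where the coordinates are normal
and principal. -/
lemma simons_identity (hu : u ∈ r.source) (hm : r.metric u = 1)
    (hΓ : ∀ c a b, christoffel r.metric c a b u = 0) (h01 : r.shape ν u 0 1 = 0)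
    (h10 : r.shape ν u 1 0 = 0) {a b : Fin 2 → ℝ}
    (ha : ∀ c, pd c (fun v => r.shape ν v 0 0) u = a c)
    (hb : ∀ c, pd c (fun v => r.shape ν v 1 1) u = b c) :
    (∀ c, pd c (r.meanCurvature ν) u = a c + b c) ∧
    (∀ c, pd c r.gauss u = r.shape ν u 1 1 * a c + r.shape ν u 0 0 * b c) ∧
    r.shape ν u 1 1 * pd 0 (pd 0 (r.meanCurvature ν)) u
        + r.shape ν u 0 0 * pd 1 (pd 1 (r.meanCurvature ν)) u =
      pd 0 (pd 0 r.gauss) u + pd 1 (pd 1 r.gauss) u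
        + r.gauss u * (r.shape ν u 0 0 - r.shape ν u 1 1) ^ 2
        + 2 * (b 0 ^ 2 - a 0 * b 0) + 2 * (a 1 ^ 2 - a 1 * b 1) := by
  have hU := r.isOpen_source
  have hA := r.contDiffOn_shape hν hκ hS
  have hAd := r.diffAt_shape hν hκ hS hu
  have hΓd := r.diffAt_christoffel hκ hS hu
  have hApd := fun c i j => diffAt_of_contDiffOn hU (HypSurface.contDiffOn_pd hU (hA i j) c) hu
  have hσ := r.contDiffOn_metric
  have hσd := fun i j => diffAt_of_contDiffOn hU (hσ i j) hu
  have hσ1 : ∀ i j, r.metric u i j = (1 : Matrix (Fin 2) (Fin 2) ℝ) i j := fun i j => by rw [hm]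
  have hσ00 : r.metric u 0 0 = 1 := by simp [hσ1]
  have hσ11 : r.metric u 1 1 = 1 := by simp [hσ1]
  have hσ01 : r.metric u 0 1 = 0 := by simp [hσ1]
  have hσ10 : r.metric u 1 0 = 0 := by simp [hσ1]
  have hpσ : ∀ c i j, pd c (fun v => r.metric v i j) u = 0 := by
    intro c i j
    rw [r.pd_metric hκ hS hu]
    simp only [hΓ]
    ring
  -- symmetry of the second fundamental form
  have hsym : Set.EqOn
      (fun v => r.metric v 0 0 * r.shape ν v 0 1 + r.metric v 0 1 * r.shape ν v 1 1)
      (fun v => r.metric v 1 0 * r.shape ν v 0 0 + r.metric v 1 1 * r.shape ν v 1 0)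
      r.source := by
    intro v hv
    simp only
    rw [r.sum_metric_mul_shape hκ hS hv, r.sum_metric_mul_shape hκ hS hv,
      r.secondForm_symm hv]
  have hsym₁ : ∀ c, pd c (fun v => r.shape ν v 0 1) u = pd c (fun v => r.shape ν v 1 0) u := by
    intro c
    have h := pd_congr (a := c) hU hu hsym
    rw [pd_add ((hσd _ _).fun_mul (hAd _ _)) ((hσd _ _).fun_mul (hAd _ _)),
      pd_add ((hσd _ _).fun_mul (hAd _ _)) ((hσd _ _).fun_mul (hAd _ _)),
      pd_mul (hσd _ _) (hAd _ _), pd_mul (hσd _ _) (hAd _ _), pd_mul (hσd _ _) (hAd _ _),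
      pd_mul (hσd _ _) (hAd _ _)] at h
    simp only [hpσ, hσ00, hσ01, hσ10, hσ11] at h
    linarith
  have hmsymm : (fun v => r.metric v 1 0) = fun v => r.metric v 0 1 :=
    funext fun v => r.metric_symm v 1 0
  -- The mixed components `A⁰₁` and `A¹₀` agree to first order at the point, but not to second: only
  -- `σA` is symmetric, so second derivatives of `σ₀₁` enter. They are expressed by Christoffel
  -- derivatives in `hmet`.
  have hsym₂ : pd 0 (pd 1 (fun v => r.shape ν v 0 1)) u
      + r.shape ν u 1 1 * pd 0 (pd 1 (fun v => r.metric v 0 1)) u =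
      pd 0 (pd 1 (fun v => r.shape ν v 1 0)) u
      + r.shape ν u 0 0 * pd 0 (pd 1 (fun v => r.metric v 0 1)) u := by
    have hpd : Set.EqOn
        (pd 1 (fun v => r.metric v 0 0 * r.shape ν v 0 1 + r.metric v 0 1 * r.shape ν v 1 1))
        (pd 1 (fun v => r.metric v 1 0 * r.shape ν v 0 0 + r.metric v 1 1 * r.shape ν v 1 0))
        r.source := fun v hv => pd_congr hU hv hsym
    have h := pd_congr (a := 0) hU hu hpd
    rw [pd_pd_add hU ((hσ _ _).mul (hA _ _)) ((hσ _ _).mul (hA _ _)) hu,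
      pd_pd_add hU ((hσ _ _).mul (hA _ _)) ((hσ _ _).mul (hA _ _)) hu,
      pd_pd_mul hU (hσ _ _) (hA _ _) hu, pd_pd_mul hU (hσ _ _) (hA _ _) hu,
      pd_pd_mul hU (hσ _ _) (hA _ _) hu, pd_pd_mul hU (hσ _ _) (hA _ _) hu] at h
    simp only [hpσ, hσ00, hσ01, hσ10, hσ11, h01, h10, hmsymm] at h
    linarith
  -- the Codazzi equations
  have hcod := fun c => r.codazzi hν hκ hS hu c
  simp only [hΓ] at hcod
  have hcod0 : pd 0 (fun v => r.shape ν v 0 1) u = a 1 := by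
    have := hcod 0
    rw [ha] at this
    linarith
  have hcod1 : pd 1 (fun v => r.shape ν v 1 0) u = b 0 := by
    have := hcod 1
    rw [hb] at this
    linarith
  have hcod₂ : ∀ e c, pd e (pd 1 (fun v => r.shape ν v c 0)) u
      + r.shape ν u 0 0 * pd e (christoffel r.metric c 1 0) u =
      pd e (pd 0 (fun v => r.shape ν v c 1)) u
      + r.shape ν u 1 1 * pd e (christoffel r.metric c 0 1) u := by
    intro e c
    have h := pd_congr (a := e) hU hu fun v hv => r.codazzi hν hκ hS hv c
    rw [pd_add_mul_add_mul e (hApd 1 c 0) (hAd _ _) (hΓd _ _ _) (hAd _ _) (hΓd _ _ _),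
      pd_add_mul_add_mul e (hApd 0 c 1) (hAd _ _) (hΓd _ _ _) (hAd _ _) (hΓd _ _ _)] at h
    simp only [hΓ, h01, h10] at h
    linarith
  have hc0 := hcod₂ 1 0
  have hc1 := hcod₂ 0 1
  rw [r.christoffel_symm _ 1 0] at hc0 hc1
  rw [pd_comm (a := 1) (b := 0) hU (hA 0 1) hu] at hc0
  -- the curvature
  have hmet : pd 0 (pd 1 (fun v => r.metric v 0 1)) u =
      pd 0 (christoffel r.metric 1 0 1) u + pd 0 (christoffel r.metric 0 1 1) u := by
    have h := pd_congr (a := 0) hU hu fun v hv => r.pd_metric hκ hS hv 1 0 1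
    have hp := fun c i j k l => (hΓd c i j).fun_mul (hσd k l)
    rw [h, pd_add ((hp _ _ _ _ _).fun_add (hp _ _ _ _ _))
        ((hp _ _ _ _ _).fun_add (hp _ _ _ _ _)),
      pd_add (hp _ _ _ _ _) (hp _ _ _ _ _), pd_add (hp _ _ _ _ _) (hp _ _ _ _ _),
      pd_mul (hΓd _ _ _) (hσd _ _), pd_mul (hΓd _ _ _) (hσd _ _),
      pd_mul (hΓd _ _ _) (hσd _ _), pd_mul (hΓd _ _ _) (hσd _ _)]
    simp only [hpσ, hσ00, hσ01, hσ10, hσ11, hΓ, r.christoffel_symm _ 1 0]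
    ring
  have hK : r.gauss u =
      pd 0 (christoffel r.metric 0 1 1) u - pd 1 (christoffel r.metric 0 0 1) u := by
    simp only [gauss, gaussCurvature, riemann, Fin.sum_univ_two, hΓ, hm]
    simp
  -- the Gauss equation
  have hgauss : Set.EqOn r.gauss (fun v => (r.shape ν v 0 0 * r.shape ν v 1 1
      - r.shape ν v 0 1 * r.shape ν v 1 0) - κ) r.source :=
    fun v hv => r.gauss_equation hν hκ hS hv
  have hdd : DifferentiableAt ℝ (fun v => r.shape ν v 0 0 * r.shape ν v 1 1
      - r.shape ν v 0 1 * r.shape ν v 1 0) u :=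
    ((hAd _ _).fun_mul (hAd _ _)).fun_sub ((hAd _ _).fun_mul (hAd _ _))
  have hg₁ : ∀ c, pd c r.gauss u = r.shape ν u 1 1 * a c + r.shape ν u 0 0 * b c := by
    intro c
    rw [pd_congr hU hu hgauss, pd_sub hdd (differentiableAt_const _), pd_const,
      pd_sub ((hAd _ _).fun_mul (hAd _ _)) ((hAd _ _).fun_mul (hAd _ _)),
      pd_mul (hAd _ _) (hAd _ _), pd_mul (hAd _ _) (hAd _ _), ha, hb, h01, h10]
    ring
  have hg₂ : ∀ c, pd c (pd c r.gauss) u =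
      r.shape ν u 1 1 * pd c (pd c (fun v => r.shape ν v 0 0)) u
      + r.shape ν u 0 0 * pd c (pd c (fun v => r.shape ν v 1 1)) u
      + 2 * (a c * b c - pd c (fun v => r.shape ν v 0 1) u ^ 2) := by
    intro c
    have hpd : Set.EqOn (pd c r.gauss) (pd c fun v => (r.shape ν v 0 0 * r.shape ν v 1 1
      - r.shape ν v 0 1 * r.shape ν v 1 0) - κ) r.source := fun v hv => pd_congr hU hv hgauss
    rw [pd_congr hU hu hpd, pd_pd_sub hU (((hA _ _).mul (hA _ _)).sub ((hA _ _).mul (hA _ _)))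
        contDiffOn_const hu,
      pd_pd_sub hU ((hA _ _).mul (hA _ _)) ((hA _ _).mul (hA _ _)) hu,
      pd_pd_mul hU (hA _ _) (hA _ _) hu, pd_pd_mul hU (hA _ _) (hA _ _) hu, ha, hb, h01, h10,
      ← hsym₁ c]
    have hz : pd c (pd c fun _ : Plane => κ) u = 0 := by
      have : (pd c fun _ : Plane => κ) = fun _ => 0 := funext fun v => pd_const κ
      rw [this, pd_const]
    rw [hz]
    ring
  have hHf : r.meanCurvature ν = fun v => r.shape ν v 0 0 + r.shape ν v 1 1 :=
    funext fun v => Matrix.trace_fin_two _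
  refine ⟨fun c => ?_, hg₁, ?_⟩
  · rw [hHf, pd_add (hAd _ _) (hAd _ _), ha, hb]
  · rw [hHf, pd_pd_add hU (hA _ _) (hA _ _) hu, pd_pd_add hU (hA _ _) (hA _ _) hu, hg₂, hg₂,
      hcod0, hsym₁ 1, hcod1, hK]
    rw [hmet] at hsym₂
    -- The sum of the three relations is `∂₁∂₁A⁰₀ - ∂₀∂₀A¹₁ = K (λ - μ)`. The two sides of the claim
    -- differ by `λ - μ` times it.
    linear_combination (r.shape ν u 0 0 - r.shape ν u 1 1) * (hc0 + hc1 + hsym₂)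

/-- The covariant Hessian of the coordinate `x⁰` in normal coordinates. -/
lemma pd_pd_pos_zero (hu : u ∈ r.source) (hm : r.metric u = 1)
    (hΓ : ∀ c a b, christoffel r.metric c a b u = 0) (c : Fin 2) :
    pd c (pd c fun v => r.toFun v 0) u =
      -(r.shape ν u c c * ν (r.toFun u) 0) + κ * r.toFun u 0 := by
  have h : Set.EqOn (pd c fun v => r.toFun v 0) (fun v => pd c r.toFun v 0) r.source :=
    fun v hv => pd_apply (r.diffAt hv) 0
  have hsh : r.secondForm ν u = r.shape ν u := by
    rw [← r.metric_mul_shape hκ hS hu, hm, Matrix.one_mul]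
  rw [pd_congr r.isOpen_source hu h, pd_apply (r.diffAt_pd hu c), r.gauss_formula hν hκ hS hu,
    hΓ, hΓ, hsh, hm]
  simp [normal]

end LocalParam

/-! ### The maximum principle -/

/-- The bound for `H = λ + μ` that the conditions at a maximum of `H exp (α φ)` imply. -/
lemma le_of_maximum_conditions {s A B lam mu φ n K K₀ K₁ K₀₀ K₁₁ H₀₀ H₁₁ : ℝ}
    {a b p : Fin 2 → ℝ} (hs : 0 < s) (hB : 0 ≤ B) (hmu : 0 ≤ mu) (hle : mu ≤ lam)
    (hφ1 : 1 ≤ s * φ) (hφA : s * φ ≤ A) (hp : ∀ c, |p c| ≤ A) (hn : |n| ≤ A)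
    (hK : K = lam * mu - s ^ 2) (hKB : |K| ≤ B) (hK₀ : |K₀| ≤ B) (hK₁ : |K₁| ≤ B)
    (hK₀₀ : |K₀₀| ≤ B) (hK₁₁ : |K₁₁| ≤ B)
    (hH : ∀ c, a c + b c = -(2 * s * (lam + mu) * p c))
    (eK₀ : K₀ = mu * a 0 + lam * b 0) (eK₁ : K₁ = mu * a 1 + lam * b 1)
    (hsimons : mu * H₀₀ + lam * H₁₁ = K₀₀ + K₁₁ + K * (lam - mu) ^ 2
      + 2 * (b 0 ^ 2 - a 0 * b 0) + 2 * (a 1 ^ 2 - a 1 * b 1))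
    (h₀₀ : H₀₀ + 2 * s * ((lam + mu) * (-(lam * n) + s ^ 2 * φ))
      - (2 * s) ^ 2 * (lam + mu) * p 0 ^ 2 ≤ 0)
    (h₁₁ : H₁₁ + 2 * s * ((lam + mu) * (-(mu * n) + s ^ 2 * φ))
      - (2 * s) ^ 2 * (lam + mu) * p 1 ^ 2 ≤ 0) :
    lam + mu ≤ 1 + 16 * (B + s ^ 2) + (2 * B
      + 8 * (2 * s) * A * (4 * (B + 2 * (2 * s) * (B + s ^ 2) * A))
      + 2 * (B + s ^ 2) * (2 * s) ^ 2 * A ^ 2 + 2 * (2 * s) * (B + s ^ 2) * A) / s ^ 2 := by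
  have hA : 1 ≤ A := hφ1.trans hφA
  have hlam : 0 ≤ lam := hmu.trans hle
  obtain ⟨α, hα⟩ : ∃ x, x = 2 * s := ⟨_, rfl⟩
  rw [← hα] at hH h₀₀ h₁₁ ⊢
  have hαpos : 0 < α := by rw [hα]; positivity
  obtain ⟨M, hM⟩ : ∃ x, x = B + s ^ 2 := ⟨_, rfl⟩
  rw [← hM]
  have hMpos : 0 < M := by rw [hM]; positivity
  obtain ⟨N, hN⟩ : ∃ x, x = 4 * (B + 2 * α * M * A) := ⟨_, rfl⟩
  rw [← hN]
  have hNpos : 0 ≤ N := by rw [hN]; positivity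
  obtain ⟨H, hHdef⟩ : ∃ x, x = lam + mu := ⟨_, rfl⟩
  rw [← hHdef] at h₀₀ h₁₁ ⊢
  simp only [← hHdef] at hH
  -- The summands `1` and `16 M` of the bound supply `H ≥ 1` and `H ≥ 16 M`; the quotient is
  -- contradicted at the end.
  by_contra! hlt
  have hD : 0 ≤ (2 * B + 8 * α * A * N + 2 * M * α ^ 2 * A ^ 2 + 2 * α * M * A) / s ^ 2 := by
    positivity
  have hH1 : 1 ≤ H := by linarith
  have hH16 : 16 * M ≤ H := by linarith
  have hHpos : 0 < H := by linarith
  have hlm : lam * mu ≤ M := by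
    have := (abs_le.1 hKB).2
    linarith
  have hlm0 : 0 ≤ lam * mu := mul_nonneg hlam hmu
  have hHl : H ≤ 2 * lam := by linarith
  -- If `4μ > λ`, then `H² ≤ 4λ² < 16 λμ ≤ 16 M ≤ H ≤ H²`.
  have hgap : H / 4 ≤ lam - mu := by
    have h1 : 16 * (lam * mu) ≤ H * H := by
      have := le_mul_of_one_le_right hHpos.le hH1
      linarith
    have h2 : 4 * mu ≤ lam := by
      by_contra! hc
      have e1 := mul_lt_mul_of_pos_left hc (by linarith : 0 < lam)
      have e2 := mul_le_mul hHl hHl hHpos.le (by linarith)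
      linarith
    linarith
  have hmuH : mu * H ≤ 2 * M := by
    have := mul_le_mul_of_nonneg_left hHl hmu
    linarith
  have hmuH0 : 0 ≤ mu * H := by positivity
  -- Eliminating `a` between the gradient of the Gauss equation and the critical point equation
  -- leaves `b (λ - μ) = ∂K + α μ H p`. The right side is bounded because `μH ≤ 2M`, and `λ - μ ≥
  -- H/4`.
  have hbN : ∀ c (k : ℝ), |k| ≤ B → k = mu * a c + lam * b c → |H * b c| ≤ N := by
    intro c k hk hkc
    have e : b c * (lam - mu) = k + α * (mu * H) * p c := by
      linear_combination -hkc + mu * (-hH c)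
    have h1 : |b c * (lam - mu)| ≤ B + 2 * α * M * A := by
      rw [e]
      refine (abs_add_le _ _).trans (add_le_add hk ?_)
      rw [abs_mul, abs_of_nonneg (by positivity)]
      calc α * (mu * H) * |p c| ≤ α * (2 * M) * A := by gcongr; exact hp c
        _ = _ := by ring
    rw [abs_mul, abs_of_nonneg (by linarith : 0 ≤ lam - mu)] at h1
    rw [abs_mul, abs_of_pos hHpos]
    have h2 := mul_le_mul_of_nonneg_left hgap (abs_nonneg (b c))
    rw [hN]
    linarith
  have hpb : ∀ c (k : ℝ), |k| ≤ B → k = mu * a c + lam * b c → -(A * N) ≤ H * p c * b c := by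
    intro c k hk hkc
    have h1 : |p c * (H * b c)| ≤ A * N := by
      rw [abs_mul]
      exact mul_le_mul (hp c) (hbN c k hk hkc) (abs_nonneg _) (by linarith)
    have := (abs_le.1 h1).1
    linarith
  have hpb0 := mul_le_mul_of_nonneg_left (hpb 0 K₀ hK₀ eK₀) hαpos.le
  have hpb1 := mul_le_mul_of_nonneg_left (hpb 1 K₁ hK₁ eK₁) hαpos.le
  have q0 : -(α * A * N) ≤ b 0 ^ 2 - a 0 * b 0 := by
    have e : a 0 = -(α * H * p 0) - b 0 := by linarith [hH 0]
    rw [e]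
    have e' : b 0 ^ 2 - (-(α * H * p 0) - b 0) * b 0 = 2 * b 0 ^ 2 + α * (H * p 0 * b 0) := by ring
    rw [e']
    linarith [sq_nonneg (b 0)]
  -- Since `a₁ = -αHp₁ - b₁`, the square `a₁²` supplies the gradient term that absorbs `α² λ H p₁²`
  -- from the weight.
  have q1 : α ^ 2 * H ^ 2 * p 1 ^ 2 - 3 * (α * A * N) ≤ a 1 ^ 2 - a 1 * b 1 := by
    have e : a 1 = -(α * H * p 1) - b 1 := by linarith [hH 1]
    rw [e]
    have e' : (-(α * H * p 1) - b 1) ^ 2 - (-(α * H * p 1) - b 1) * b 1 =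
        α ^ 2 * H ^ 2 * p 1 ^ 2 + 3 * (α * (H * p 1 * b 1)) + 2 * b 1 ^ 2 := by ring
    rw [e']
    linarith [sq_nonneg (b 1)]
  have qK : -(s ^ 2 * H ^ 2) ≤ K * (lam - mu) ^ 2 := by
    have h1 : (lam - mu) ^ 2 ≤ H ^ 2 := by
      have : H ^ 2 = (lam - mu) ^ 2 + 4 * (lam * mu) := by rw [hHdef]; ring
      linarith
    have h2 : -(s ^ 2) ≤ K := by linarith
    have h3 := mul_le_mul_of_nonneg_right h2 (sq_nonneg (lam - mu))
    have h4 := mul_le_mul_of_nonneg_left h1 (sq_nonneg s)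
    linarith
  have m0 := mul_nonpos_of_nonneg_of_nonpos hmu h₀₀
  have m1 := mul_nonpos_of_nonneg_of_nonpos hlam h₁₁
  -- The choice `α = 2s` gives twice what is needed against the loss `s² H²` in `qK`.
  have hφH : 2 * s ^ 2 * H ^ 2 ≤ α * H * (s ^ 2 * φ * H) := by
    have e : α * H * (s ^ 2 * φ * H) = (2 * s ^ 2 * H ^ 2) * (s * φ) := by rw [hα]; ring
    rw [e]
    exact le_mul_of_one_le_right (by positivity) hφ1
  have hnn : α * H * (2 * (lam * mu) * n) ≤ 2 * α * M * A * H := by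
    have h1 : (lam * mu) * n ≤ M * A :=
      (mul_le_mul_of_nonneg_left (le_of_abs_le hn) hlm0).trans
        (mul_le_mul_of_nonneg_right hlm (by linarith))
    have := mul_le_mul_of_nonneg_left h1 (by positivity : 0 ≤ 2 * α * H)
    linarith
  have hp0 : p 0 ^ 2 ≤ A ^ 2 := sq_le_sq' (abs_le.1 (hp 0)).1 (abs_le.1 (hp 0)).2
  have g0 : α ^ 2 * (mu * H) * p 0 ^ 2 ≤ α ^ 2 * (2 * M) * A ^ 2 := by gcongr
  have g1 : α ^ 2 * (lam * H) * p 1 ^ 2 ≤ α ^ 2 * (H * H) * p 1 ^ 2 := by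
    gcongr
    linarith
  have hpos1 : 0 ≤ α ^ 2 * H ^ 2 * p 1 ^ 2 := by positivity
  have hk0 := (abs_le.1 hK₀₀).1
  have hk1 := (abs_le.1 hK₁₁).1
  -- Add μ times the first second-order condition and λ times the second, then insert the Simons
  -- identity. The coefficient 8 is `2·1 + 2·3` from `q0` and `q1`.
  have hfin : s ^ 2 * H ^ 2 ≤ 2 * B + 8 * α * A * N + 2 * M * α ^ 2 * A ^ 2
      + 2 * α * M * A * H := by
    have e1 : mu * (H₀₀ + α * (H * (-(lam * n) + s ^ 2 * φ)) - α ^ 2 * H * p 0 ^ 2)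
        + lam * (H₁₁ + α * (H * (-(mu * n) + s ^ 2 * φ)) - α ^ 2 * H * p 1 ^ 2) =
        (mu * H₀₀ + lam * H₁₁) - α * H * (2 * (lam * mu) * n) + α * H * (s ^ 2 * φ * H)
        - α ^ 2 * (mu * H) * p 0 ^ 2 - α ^ 2 * (lam * H) * p 1 ^ 2 := by
      rw [hHdef]; ring
    rw [hsimons] at e1
    linarith
  have hfin' : s ^ 2 * H ^ 2 ≤ (2 * B + 8 * α * A * N + 2 * M * α ^ 2 * A ^ 2
      + 2 * α * M * A) * H := by
    have : 0 ≤ 2 * B + 8 * α * A * N + 2 * M * α ^ 2 * A ^ 2 := by positivity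
    have := le_mul_of_one_le_right this hH1
    linarith
  have hdiv : H ≤ (2 * B + 8 * α * A * N + 2 * M * α ^ 2 * A ^ 2 + 2 * α * M * A) / s ^ 2 := by
    rw [le_div_iff₀ (by positivity)]
    exact le_of_mul_le_mul_right (by linarith) hHpos
  linarith

/-! ### Pointwise bounds from the norms -/

section Norms

variable {S : Set R31} {B : ℝ≥0}

lemma abs_le_of_enorm_le {x : ℝ} (h : ‖x‖ₑ ≤ (B : ℝ≥0∞)) : |x| ≤ B := by
  rw [enorm_le_coe] at h
  exact_mod_cast h

lemma abs_le_of_c0Norm_le {φ : R31 → ℝ} (h : c0Norm S φ ≤ (B : ℝ≥0∞)) {p : R31} (hp : p ∈ S) :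
    |φ p| ≤ B :=
  abs_le_of_enorm_le ((le_iSup₂ (f := fun p (_ : p ∈ S) => ‖φ p‖ₑ) p hp).trans h)

lemma abs_le_of_supNorm_le {Q : LocalParam S → Plane → ℝ} (h : supNorm S Q ≤ (B : ℝ≥0∞))
    (r : LocalParam S) {u : Plane} (hu : u ∈ r.source) : |Q r u| ≤ B := by
  refine abs_le_of_enorm_le (le_trans ?_ h)
  exact (le_iSup₂ (f := fun u (_ : u ∈ r.source) => ‖Q r u‖ₑ) u hu).trans
    (le_iSup (fun r : LocalParam S => ⨆ u ∈ r.source, ‖Q r u‖ₑ) r)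

lemma abs_pd_le_gradNorm {σ : Plane → Matrix (Fin 2) (Fin 2) ℝ} {φ : Plane → ℝ} {u : Plane}
    (hσ : σ u = 1) (c : Fin 2) : |pd c φ u| ≤ gradNorm σ φ u := by
  apply Real.abs_le_sqrt
  rw [hσ]
  simp [Matrix.one_apply]
  fin_cases c <;> simp <;> nlinarith [sq_nonneg (pd 0 φ u), sq_nonneg (pd 1 φ u)]

/-- In normal coordinates the covariant Hessian at the point is the matrix of second partial
derivatives, and its norm is Euclidean. -/
lemma abs_pd_pd_le_hessNorm {σ : Plane → Matrix (Fin 2) (Fin 2) ℝ} {φ : Plane → ℝ} {u : Plane}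
    (hσ : σ u = 1) (hΓ : ∀ c a b, christoffel σ c a b u = 0) (c : Fin 2) :
    |pd c (pd c φ) u| ≤ hessNorm σ φ u := by
  apply Real.abs_le_sqrt
  rw [hσ]
  simp [Matrix.one_apply, hessian, hΓ]
  fin_cases c <;> simp <;>
    nlinarith [mul_self_nonneg (pd 0 (pd 0 φ) u), mul_self_nonneg (pd 0 (pd 1 φ) u),
      mul_self_nonneg (pd 1 (pd 0 φ) u), mul_self_nonneg (pd 1 (pd 1 φ) u)]

end Norms

open LocalParam Filter Topology in
/-- The bound for the mean curvature at a maximum point of `H exp (2 √κ x⁰)`. -/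
lemma meanCurvature_le_of_isMaxOn {S : Set R31} {κ : ℝ} {ν : R31 → R31} {A B : ℝ≥0}
    (hκ : 0 < κ) (hS : IsClosedSurface κ S) (hν : IsUnitNormal S ν) (hc : IsConvexWith S ν)
    (hA : c0Norm S (staticPotential κ) ≤ (A : ℝ≥0∞)) (hB : gaussC2Norm S ≤ (B : ℝ≥0∞))
    {H : R31 → ℝ}
    (hH : ∀ r : LocalParam S, ∀ u ∈ r.source, H (r.toFun u) = r.meanCurvature ν u) {p : R31}
    (hp : p ∈ S) (hmax : IsMaxOn (fun x => H x * Real.exp (2 * Real.sqrt κ * x 0)) S p) :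
    H p ≤ 1 + 16 * (B + Real.sqrt κ ^ 2) + (2 * B
      + 8 * (2 * Real.sqrt κ) * A * (4 * (B + 2 * (2 * Real.sqrt κ) * (B + Real.sqrt κ ^ 2) * A))
      + 2 * (B + Real.sqrt κ ^ 2) * (2 * Real.sqrt κ) ^ 2 * A ^ 2
      + 2 * (2 * Real.sqrt κ) * (B + Real.sqrt κ ^ 2) * A) / Real.sqrt κ ^ 2 := by
  obtain ⟨r₀, u₀, hu₀, rfl⟩ := hS.exists_param p hp
  obtain ⟨r, u, hu, hru, hm, hΓ, h01, h10, hle⟩ := r₀.exists_adapted hν hκ hS.subset hu₀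
  rw [← hru] at hp hmax ⊢
  have hsκ : Real.sqrt κ ^ 2 = κ := Real.sq_sqrt hκ.le
  have hph := hS.subset hp
  have hφ : ContDiffOn ℝ ∞ (fun v => r.toFun v 0) r.source := contDiffOn_pi.1 r.contDiffOn 0
  have hHf : r.meanCurvature ν = fun v => r.shape ν v 0 0 + r.shape ν v 1 1 :=
    funext fun v => Matrix.trace_fin_two _
  have hHs : ContDiffOn ℝ ∞ (r.meanCurvature ν) r.source := by
    rw [hHf]
    exact (r.contDiffOn_shape hν hκ hS.subset 0 0).add (r.contDiffOn_shape hν hκ hS.subset 1 1)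
  have hloc : IsLocalMax
      (fun v => r.meanCurvature ν v * Real.exp (2 * Real.sqrt κ * r.toFun v 0)) u := by
    filter_upwards [r.isOpen_source.mem_nhds hu] with v hv
    have := hmax (r.mem_surface hv)
    simp only [Set.mem_ofPred_eq, hH r v hv, hH r u hu] at this
    exact this
  have hcond := conditions_of_isLocalMax_mul_exp r.isOpen_source hHs hφ hu _ hloc
  have hsh : ∀ i j, r.secondForm ν u i j = r.shape ν u i j := by
    intro i j
    rw [← r.metric_mul_shape hκ hS.subset hu, hm, Matrix.one_mul]
  have hmu : 0 ≤ r.shape ν u 1 1 := by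
    have := hc r u hu (Pi.single 1 1)
    simpa [Fin.sum_univ_two, hsh] using this
  have hstat : Real.sqrt κ * r.toFun u 0 ≤ A := by
    rw [← staticPotential_eq hκ hph]
    exact (le_abs_self _).trans (abs_le_of_c0Norm_le hA hp)
  have hone : 1 ≤ Real.sqrt κ * r.toFun u 0 := by
    have h0 : 0 ≤ Real.sqrt κ * r.toFun u 0 := mul_nonneg (Real.sqrt_nonneg _) hph.2.le
    rw [← one_le_sq_iff₀ h0, mul_pow, hsκ]
    exact one_le_mul_sq hκ hph
  have hB₀ : supNorm S (fun r => r.gauss) ≤ (B : ℝ≥0∞) :=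
    (le_self_add.trans le_self_add).trans hB
  have hB₁ : supNorm S (fun r => gradNorm r.metric r.gauss) ≤ (B : ℝ≥0∞) :=
    (le_add_self.trans le_self_add).trans hB
  have hB₂ : supNorm S (fun r => hessNorm r.metric r.gauss) ≤ (B : ℝ≥0∞) :=
    le_add_self.trans hB
  have hK₁ : ∀ c, |pd c r.gauss u| ≤ B := fun c =>
    (abs_pd_le_gradNorm hm c).trans ((le_abs_self _).trans (abs_le_of_supNorm_le hB₁ r hu))
  have hK₂ : ∀ c, |pd c (pd c r.gauss) u| ≤ B := fun c =>
    (abs_pd_pd_le_hessNorm hm hΓ c).trans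
      ((le_abs_self _).trans (abs_le_of_supNorm_le hB₂ r hu))
  obtain ⟨e1, e2, e3⟩ := r.simons_identity hν hκ hS.subset hu hm hΓ h01 h10
    (fun c => rfl) (fun c => rfl)
  have hHu : r.meanCurvature ν u = r.shape ν u 0 0 + r.shape ν u 1 1 := congrFun hHf u
  have hgrad : ∀ c, |pd c (fun v => r.toFun v 0) u| ≤ A := by
    intro c
    rw [pd_apply (r.diffAt hu) 0]
    refine (abs_zero_le_of_unit_tangent hκ hph (r.lorentz_pos_pd hS.subset hu c) ?_).trans hstat
    change r.metric u c c = 1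
    simp [hm]
  have hnorm : |ν (r.toFun u) 0| ≤ A :=
    (abs_zero_le_of_unit_tangent hκ hph (hν.tangent _ hp) (hν.unit _ hp)).trans hstat
  have hhess := r.pd_pd_pos_zero hν hκ hS.subset hu hm hΓ
  have hsecond := fun c => (hcond c).2
  simp only [hhess, hHu] at hsecond
  have hfirst := fun c => (hcond c).1
  rw [hH r u hu, hHu]
  refine le_of_maximum_conditions (Real.sqrt_pos.2 hκ) B.2 hmu hle hone hstat hgrad hnorm
    (K := r.gauss u) (H₀₀ := pd 0 (pd 0 (r.meanCurvature ν)) u)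
    (H₁₁ := pd 1 (pd 1 (r.meanCurvature ν)) u) (a := fun c => pd c (fun v => r.shape ν v 0 0) u)
    (b := fun c => pd c (fun v => r.shape ν v 1 1) u) ?_ (abs_le_of_supNorm_le hB₀ r hu) (hK₁ 0) (hK₁ 1) (hK₂ 0) (hK₂ 1)
    (fun c => ?_) (e2 0) (e2 1) e3 ?_ ?_
  · rw [r.gauss_equation hν hκ hS.subset hu, h01, hsκ]
    ring
  · rw [← e1, hfirst, hHu]
  · rw [hsκ]; exact hsecond 0
  · rw [hsκ]; exact hsecond 1

end HypSurface

end

theorem theoremB (κ : ℝ) (hκ : 0 < κ) (A B : ℝ≥0) :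
    ∃ C : ℝ, ∀ (S : Set HypSurface.R31) (ν : HypSurface.R31 → HypSurface.R31),
      HypSurface.IsClosedSurface κ S →
      HypSurface.IsUnitNormal S ν →
      HypSurface.IsConvexWith S ν →
      HypSurface.c0Norm S (HypSurface.staticPotential κ) ≤ (A : ℝ≥0∞) →
      HypSurface.gaussC2Norm S ≤ (B : ℝ≥0∞) →
      ∀ r : HypSurface.LocalParam S, ∀ u ∈ r.source, r.meanCurvature ν u ≤ C := by
  set s := Real.sqrt κ with hs
  set C₀ : ℝ := 1 + 16 * (B + s ^ 2) + (2 * B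
      + 8 * (2 * s) * A * (4 * (B + 2 * (2 * s) * (B + s ^ 2) * A))
      + 2 * (B + s ^ 2) * (2 * s) ^ 2 * A ^ 2 + 2 * (2 * s) * (B + s ^ 2) * A) / s ^ 2 with hC₀
  have hspos : 0 < s := Real.sqrt_pos.2 hκ
  have hC₀pos : 0 ≤ C₀ := by positivity
  -- The weight is at least 1 everywhere on `S` and at most `exp (2A)` at the maximum point, so
  -- comparing values of `H exp (2 s x⁰)` costs only this factor.
  refine ⟨C₀ * Real.exp (2 * A), fun S ν hS hν hc hA hB r u hu => ?_⟩
  obtain ⟨H, hHc, hH⟩ := HypSurface.exists_continuousOn_meanCurvature hκ hS hν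
  have hQ : ContinuousOn (fun x : HypSurface.R31 => H x * Real.exp (2 * s * x 0)) S :=
    hHc.mul (by fun_prop)
  obtain ⟨p, hp, hmax⟩ := hS.isCompact.exists_isMaxOn hS.isConnected.nonempty hQ
  have hHp := HypSurface.meanCurvature_le_of_isMaxOn hκ hS hν hc hA hB hH hp hmax
  have hru := r.mem_surface hu
  have hmax' : H (r.toFun u) * Real.exp (2 * s * r.toFun u 0) ≤ H p * Real.exp (2 * s * p 0) :=
    hmax hru
  have hp0 : s * p 0 ≤ A := by
    rw [← HypSurface.staticPotential_eq hκ (hS.subset hp)]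
    exact (le_abs_self _).trans (HypSurface.abs_le_of_c0Norm_le hA hp)
  have hexp : (1 : ℝ) ≤ Real.exp (2 * s * r.toFun u 0) := by
    apply Real.one_le_exp
    have := (hS.subset hru).2
    positivity
  rw [← hH r u hu]
  rcases le_or_gt (H (r.toFun u)) 0 with h0 | h0
  · exact h0.trans (by positivity)
  calc H (r.toFun u) ≤ H (r.toFun u) * Real.exp (2 * s * r.toFun u 0) :=
        le_mul_of_one_le_right h0.le hexp
    _ ≤ H p * Real.exp (2 * s * p 0) := hmax'
    _ ≤ C₀ * Real.exp (2 * s * p 0) := by gcongr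
    _ ≤ C₀ * Real.exp (2 * A) := by gcongr C₀ * Real.exp ?_; linarith
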